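/- **Network.** Let $G=(\mathcal V,\mathcal E)$ be a finite acyclic ADT network: each supernode $V\in\mathcal V$ has a finite set $I(V)$ of input ports and a finite set $O(V)$ of output ports, $\mathcal E$ is a set of edges from output ports to input ports, and the directed graph on $\mathcal V$ with $V\to W$ whenever some edge runs from $O(V)$ to $I(W)$ has no directed cycle. Let $\mathbb F_q$ be a finite field. For supernodes $S\neq T$, $mincut(S,T)=\min_\Omega \operatorname{rank}(G_\Omega)$, where $\Omega$ ranges over the sets of supernodes with $S\in\Omega$, $T\notin\Omega$, and $G_\Omega$ is the $0$–$1$ incidence matrix over $\mathbb F_q$ between the output ports in $\Omega$ and the input ports in $\Omega^c$. **Codes.** The source $S$ multicasts $R=|\mathcal X(S)|$ processes to destinations $T_1,\dots,T_N\ne S$. A code assigns values in $\mathbb F_q$ to the code variables: $\alpha_{(k,e)}$ ($1\le k\le R$, $e\in O(S)$), $\beta_{(e',e)}$ ($e'\in I(V)$, $e\in O(V)$, $V\in\mathcal V$) and $\epsilon_{(e',(T_i,k))}$ ($e'\in I(T_i)$, $1\le k\le R$). Let $F$ be the matrix on the set of all ports with entry $1$ at $(e,e')\in\mathcal E$, entry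 $\beta_{(e',e)}$ at $(e',e)\in I(V)\times O(V)$, and $0$ elsewhere; let $A$ be the encoding matrix with entries $\alpha_{(k,e)}$ at $(k,e)$ for $e\in O(S)$, and $0$ elsewhere; let $B_i$ be the decoding matrix with entries $\epsilon_{(e',(T_i,k))}$ at $(k,e')$ for $e'\in I(T_i)$, and $0$ elsewhere. The processes at the ports are $Y=\mathcal X(S)A(I-F)^{-1}$, and the output of $T_i$ is $\mathcal Z(T_i)=\mathcal X(S)M_i$ with $M_i=A(I-F)^{-1}B_i^{T}$. *$T_i$ can decode* if $\mathcal X(S)$ is a function of the symbols $Y(e')$, $e'\in I(T_i)$, that it receives. **Random coding.** Let $J$ be any set (some or all) of the code variables. The variables in $J$ are drawn independently and uniformly from $\mathbb F_q$, and the others have arbitrary fixed values. Let $\eta$ be the number of links carrying random combinations, that is, of output ports $e$ that are the tail of at least one edge and have at least one coefficient $\alpha_{(k,e)}$ or $\beta_{(e',e)}$ in $J$ (the edges leaving one output port form one broadcast link). Let $\delta$ be the maximum over $i$ of the number of $k$ such that some $\epsilon_{(e',(T_i,k))}$ is in $J$; thus $\delta=0$ if no decoding coefficient is random. **Corollary (Random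 Coding for Multicast).** Suppose that $q>N$ and $mincut(S,T_i)\ge R$ for all $i$. Then: 1. There is a code for which $M_1,\dots,M_N$ are all invertible. 2. If for each $i$ the fixed values can be completed, by some values for the variables in $J$, to a code for which $T_i$ can decode, then all destinations can decode simultaneously with probability at least $(1-\frac Nq)^{\eta}$. 3. If for each $i$ the fixed values can be completed, by some values for the variables in $J$, to a code for which $M_i$ is invertible, then $M_1,\dots,M_N$ are all invertible (so that every destination recovers $\mathcal X(S)$ from $\mathcal Z(T_i)$, formed with the drawn decoding coefficients) with probability at least $(1-\frac Nq)^{\eta+\delta}$. 4. $\eta\le|\mathcal E|$, and $\eta+\delta$ is at most the total number of ports. If all code variables are random, or more generally if the values fixed outside $J$ are those of a code as in 1, the conditions in 2 and 3 hold. -/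

import Mathlib

open scoped Matrix

/-- An ADT network: every input port and every output port belongs to a supernode, and the edges
run from output ports to input ports. All edges leaving one output port form one (broadcast)
link. -/
structure ADTNetwork (V I O : Type*) where
  /-- the supernode to which an input port belongs -/
  inNode : I → V
  /-- the supernode to which an output port belongs -/
  outNode : O → V
  /-- the edge set -/
  edges : Finset (O × I)

namespace ADTNetwork

variable {V I O : Type*}

/-- There is an edge from an output port of `v` to an input port of `w`. -/
def Link (G : ADTNetwork V I O) (v w : V) : Prop :=
  ∃ e ∈ G.edges, G.outNode e.1 = v ∧ G.inNode e.2 = w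

/-- The supernode graph has no directed cycle. -/
def Acyclic (G : ADTNetwork V I O) : Prop :=
  ∀ v, ¬ Relation.TransGen G.Link v v

/-- The set `I(v)` of input ports of a supernode. -/
abbrev InPort (G : ADTNetwork V I O) (v : V) : Type _ := {e : I // G.inNode e = v}

/-- The set `O(v)` of output ports of a supernode. -/
abbrev OutPort (G : ADTNetwork V I O) (v : V) : Type _ := {e : O // G.outNode e = v}

section MinCut

variable [Fintype I] [DecidableEq V] [DecidableEq I] [DecidableEq O]

/-- The incidence matrix `G_Ω`, over the field `F`, of the bipartite graph between the output
ports of the supernodes in `Ω` and the input ports of the supernodes outside `Ω`. -/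
def cutMatrix (G : ADTNetwork V I O) (F : Type*) [Field F] (Ω : Finset V) :
    Matrix {e : O // G.outNode e ∈ Ω} {e : I // G.inNode e ∉ Ω} F :=
  Matrix.of fun e e' => if (e.1, e'.1) ∈ G.edges then 1 else 0

/-- `mincut(S, T)`: the minimum of `rank G_Ω` over all cuts `Ω` with `S ∈ Ω` and `T ∉ Ω`. -/
noncomputable def mincut (G : ADTNetwork V I O) (F : Type*) [Field F] (S T : V) : ℕ :=
  sInf {r : ℕ | ∃ Ω : Finset V, S ∈ Ω ∧ T ∉ Ω ∧ (G.cutMatrix F Ω).rank = r}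

end MinCut

/-- The code variables for a multicast of `R` source processes from `S` to `T 0, …, T (N - 1)`:
* `α (k, e)` for a source process `k` and an output port `e` of `S`;
* `β (e', e)` for an input port `e'` and an output port `e` of one and the same supernode;
* `ε (e', (i, k))` for an input port `e'` of `T i` and an output process `k` of `T i`. -/
abbrev CodeVar (G : ADTNetwork V I O) (S : V) {N : ℕ} (T : Fin N → V) (R : ℕ) : Type _ :=
  (Fin R × G.OutPort S) ⊕ {p : I × O // G.inNode p.1 = G.outNode p.2} ⊕
    (Σ i : Fin N, G.InPort (T i) × Fin R)

variable {G : ADTNetwork V I O} {S : V} {N : ℕ} {T : Fin N → V} {R : ℕ}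

/-- The variable `α (k, e)`. -/
abbrev CodeVar.α (k : Fin R) (e : G.OutPort S) : G.CodeVar S T R := Sum.inl (k, e)

/-- The variable `β (e', e)`. -/
abbrev CodeVar.β (e' : I) (e : O) (h : G.inNode e' = G.outNode e) : G.CodeVar S T R :=
  Sum.inr (Sum.inl ⟨(e', e), h⟩)

/-- The variable `ε (e', (i, k))`. -/
abbrev CodeVar.ε (i : Fin N) (e' : G.InPort (T i)) (k : Fin R) : G.CodeVar S T R :=
  Sum.inr (Sum.inr ⟨i, e', k⟩)

section Coding

variable {F : Type*} [Field F] [DecidableEq V] [DecidableEq I] [DecidableEq O]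

/-- The adjacency matrix `F` on the ports, for the values `c` of the code variables. -/
def adjMatrix (c : G.CodeVar S T R → F) : Matrix (I ⊕ O) (I ⊕ O) F :=
  Matrix.of fun p p' =>
    match p, p' with
    | Sum.inr e, Sum.inl e' => if (e, e') ∈ G.edges then 1 else 0
    | Sum.inl e', Sum.inr e =>
        if h : G.inNode e' = G.outNode e then c (CodeVar.β e' e h) else 0
    | _, _ => 0

/-- The encoding matrix `A`. -/
def encMatrix (c : G.CodeVar S T R → F) : Matrix (Fin R) (I ⊕ O) F :=
  Matrix.of fun k p =>
    match p with
    | Sum.inr e => if h : G.outNode e = S then c (CodeVar.α k ⟨e, h⟩) else 0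
    | Sum.inl _ => 0

/-- The block `B i` of the decoding matrix that belongs to the destination `T i`. -/
def decMatrix (c : G.CodeVar S T R → F) (i : Fin N) : Matrix (Fin R) (I ⊕ O) F :=
  Matrix.of fun k p =>
    match p with
    | Sum.inl e' => if h : G.inNode e' = T i then c (CodeVar.ε i ⟨e', h⟩ k) else 0
    | Sum.inr _ => 0

variable [Fintype I] [Fintype O]

/-- The block `M i = A (1 - F)⁻¹ (B i)ᵀ` of the system matrix: `Z (T i) = X(S) * M i`. -/
noncomputable def systemMatrix (c : G.CodeVar S T R → F) (i : Fin N) :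
    Matrix (Fin R) (Fin R) F :=
  encMatrix c * (1 - adjMatrix c)⁻¹ * (decMatrix c i)ᵀ

/-- The symbols received at the input ports of `T i` when the source symbols are `x`. -/
noncomputable def received (c : G.CodeVar S T R → F) (i : Fin N) (x : Fin R → F) :
    G.InPort (T i) → F :=
  fun e => (x ᵥ* (encMatrix c * (1 - adjMatrix c)⁻¹)) (Sum.inl e.1)

/-- The destination `T i` can recover all source symbols from the symbols that it receives. -/
def CanDecode (c : G.CodeVar S T R → F) (i : Fin N) : Prop :=
  ∃ g : (G.InPort (T i) → F) → (Fin R → F), ∀ x, g (received c i x) = x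

end Coding

/-- `c` agrees with `c₀` at every code variable outside `J`. -/
def AgreeOff {F : Type*} (J : Set (G.CodeVar S T R)) (c₀ c : G.CodeVar S T R → F) : Prop :=
  ∀ v, v ∉ J → c v = c₀ v

/-- The probability of the event `P` when the code variables in `J` are drawn independently and
uniformly from the finite field `F` and the others keep their values in `c₀`, that is, when the
code is uniformly distributed over the finitely many `c` that agree with `c₀` outside `J`. -/
noncomputable def randomCodeProb {F : Type*} (J : Set (G.CodeVar S T R))
    (c₀ : G.CodeVar S T R → F) (P : (G.CodeVar S T R → F) → Prop) : ℝ :=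
  (Nat.card {c : G.CodeVar S T R → F // AgreeOff J c₀ c ∧ P c} : ℝ) /
    (Nat.card {c : G.CodeVar S T R → F // AgreeOff J c₀ c} : ℝ)

/-- `η`: the number of links that carry random combinations, that is, of output ports that are
the tail of some edge and have at least one random coefficient. -/
noncomputable def numRandomLinks (J : Set (G.CodeVar S T R)) : ℕ :=
  Nat.card {e : O // (∃ e', (e, e') ∈ G.edges) ∧
    ((∃ (k : Fin R) (h : G.outNode e = S), (CodeVar.α k ⟨e, h⟩ : G.CodeVar S T R) ∈ J) ∨
      ∃ (e' : I) (h : G.inNode e' = G.outNode e),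
        (CodeVar.β e' e h : G.CodeVar S T R) ∈ J)}

/-- `δ`: the largest number, over the destinations `T i`, of output processes of `T i` that are
formed with at least one random decoding coefficient. -/
noncomputable def numRandomOutputs (J : Set (G.CodeVar S T R)) : ℕ :=
  Finset.univ.sup fun i : Fin N =>
    Nat.card {k : Fin R // ∃ e' : G.InPort (T i), (CodeVar.ε i e' k : G.CodeVar S T R) ∈ J}

end ADTNetwork

/-! By the Schur complement, `systemMatrix c i` is invertible exactly when the block matrix
`portMatrix c i`, with rows `(1 - F, Bᵢᵀ)` and `(A, 0)`, has nonzero determinant. No inverse occurs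
in it: all coefficients of an output port stand in the column of that port, and those of an output
process in the column of that process. The determinant is therefore affine in the coefficients of
one column jointly. An affine function that is not identically zero vanishes on at most a `1 / q`
fraction of the points, so drawing the columns one after another, with a union bound over the `N`
destinations, costs a factor `1 - N / q` per random column (`pow_mul_card_le_card_filter_ne_zero`).
Ports without an outgoing edge cost nothing. Decoding columns of different destinations share a
factor, since the determinant for `T i` contains no decoding coefficient of another destination;
hence `δ` is a maximum and not a sum.

That a single destination can be served is shown over an infinite field, by eliminating all
supernodes except `S` and `T i` one at a time. A cut `Ω` of the network without `v` comes from the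
two cuts `Ω` and `Ω ∪ {v}` of the network with `v`; if both have rank at least `R`, some choice of
coefficients at `v` preserves this bound (`Matrix.exists_le_rank_add_mul_mul`), and a generic choice
does so for all cuts at once. In the end the transfer matrix from `S` to `T i` has rank at least
`R`. Since the determinant is affine in each variable, the resulting code can be moved to one with
values `0` and `1`, which exists over every field. All destinations are then served by one code
because the probability bound is positive for `q > N`. -/

/-! ### Rank and determinant lemmas -/

section LinearAlgebra

variable {K m n : Type*} [Field K] [Fintype m] [Fintype n]

/-- A matrix with linearly independent columns has a left inverse. -/
theorem Matrix.exists_mul_eq_one_of_mulVec_injective [DecidableEq m] [DecidableEq n]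
    (Y : Matrix m n K) (hY : Function.Injective Y.mulVec) : ∃ a : Matrix n m K, a * Y = 1 := by
  obtain ⟨g, hg⟩ := LinearMap.exists_leftInverse_of_injective (Matrix.toLin' Y)
    (LinearMap.ker_eq_bot.2 hY)
  refine ⟨LinearMap.toMatrix' g, ?_⟩
  have h := congrArg LinearMap.toMatrix' hg
  rwa [LinearMap.toMatrix'_comp, LinearMap.toMatrix'_toLin', LinearMap.toMatrix'_id] at h

/-- A matrix has rank at least `r` if and only if it can be reduced to the `r × r` identity. -/
theorem Matrix.le_rank_iff_exists_mul_mul_eq_one (Y : Matrix m n K) (r : ℕ) :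
    r ≤ Y.rank ↔ ∃ (a : Matrix (Fin r) m K) (b : Matrix n (Fin r) K), a * Y * b = 1 := by
  classical
  constructor
  · intro h
    obtain ⟨f, hf⟩ := exists_linearIndependent_of_le_finrank (R := K)
      (M := LinearMap.range Y.mulVecLin) h
    choose w hw using fun j => (f j).2
    let b : Matrix n (Fin r) K := Matrix.of fun x j => w j x
    have hcol : (Y * b).col = fun j => (f j : m → K) := by
      funext j
      rw [← hw j]
      rfl
    have hinj : Function.Injective (Y * b).mulVec := by
      rw [Matrix.mulVec_injective_iff, hcol]
      exact hf.map' (Submodule.subtype _) (Submodule.ker_subtype _)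
    obtain ⟨a, ha⟩ := (Y * b).exists_mul_eq_one_of_mulVec_injective hinj
    exact ⟨a, b, by rw [Matrix.mul_assoc, ha]⟩
  · rintro ⟨a, b, hab⟩
    have h1 : (a * Y * b).rank ≤ Y.rank :=
      (Matrix.rank_mul_le_left _ _).trans (Matrix.rank_mul_le_right _ _)
    rwa [hab, Matrix.rank_one, Fintype.card_fin] at h1

/-- If `P + Q` and `P + U` both have rank at least `R`, then so does `P + Q β U` for some `β`. -/
theorem Matrix.exists_le_rank_add_mul_mul (P Q U : Matrix m n K) (R : ℕ)
    (hQ : R ≤ (P + Q).rank) (hU : R ≤ (P + U).rank) :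
    ∃ β : Matrix n m K, R ≤ (P + Q * β * U).rank := by
  classical
  suffices h : ∀ r ≤ R, ∃ β : Matrix n m K, r ≤ (P + Q * β * U).rank from h R le_rfl
  intro r
  induction r with
  | zero => exact fun _ => ⟨0, Nat.zero_le _⟩
  | succ r ih =>
    intro hr
    obtain ⟨β, hβ⟩ := ih (by omega)
    rcases Nat.lt_or_ge r (P + Q * β * U).rank with h | h
    · exact ⟨β, h⟩
    set P' := P + Q * β * U with hP'
    have hrank : P'.rank < R := by omega
    -- Otherwise `P' x = 0` forces `U x = 0`, hence `P x = 0`, so `ker P' ≤ ker (P + U)` and `rank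
    -- (P + U) ≤ rank P' < R`.
    obtain ⟨x, hx, hUx⟩ : ∃ x, P' *ᵥ x = 0 ∧ U *ᵥ x ≠ 0 := by
      by_contra! hcon
      have hker : LinearMap.ker P'.mulVecLin ≤ LinearMap.ker (P + U).mulVecLin := by
        intro x hx
        have hx' : P' *ᵥ x = 0 := hx
        have hu := hcon x hx'
        rw [hP', Matrix.add_mulVec, ← Matrix.mulVec_mulVec, hu, Matrix.mulVec_zero,
          add_zero] at hx'
        change (P + U) *ᵥ x = 0
        rw [Matrix.add_mulVec, hx', hu, add_zero]
      have h1 := Submodule.finrank_mono hker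
      have h2 := LinearMap.finrank_range_add_finrank_ker P'.mulVecLin
      have h3 := LinearMap.finrank_range_add_finrank_ker (P + U).mulVecLin
      rw [Matrix.rank] at hU hrank
      omega
    -- Dually, if the range of `P'` contained all columns of `Q`, it would contain the range of `P +
    -- Q`.
    obtain ⟨j, hj⟩ : ∃ j, Q.col j ∉ LinearMap.range P'.mulVecLin := by
      by_contra! hcon
      have hQr : ∀ y, Q *ᵥ y ∈ LinearMap.range P'.mulVecLin := by
        intro y
        have : Q *ᵥ y ∈ LinearMap.range Q.mulVecLin := ⟨y, rfl⟩
        rw [Matrix.range_mulVecLin] at this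
        refine Submodule.span_le.2 ?_ this
        rintro _ ⟨j, rfl⟩
        exact hcon j
      have hle : LinearMap.range (P + Q).mulVecLin ≤ LinearMap.range P'.mulVecLin := by
        rintro _ ⟨y, rfl⟩
        have h : (P + Q).mulVecLin y = P' *ᵥ y + Q *ᵥ (y - β *ᵥ (U *ᵥ y)) := by
          simp only [hP', Matrix.mulVecLin_apply, Matrix.add_mulVec, Matrix.mulVec_sub,
            Matrix.mulVec_mulVec, Matrix.mul_assoc]
          abel
        rw [h]
        exact add_mem ⟨y, rfl⟩ (hQr _)
      have := Submodule.finrank_mono hle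
      rw [Matrix.rank] at hQ hrank
      omega
    obtain ⟨i, hi⟩ := Function.ne_iff.1 hUx
    -- This adds to `P'` the rank-one matrix column `j` of `Q` times row `i` of `U`. As the column
    -- lies outside the range of `P'`, the new kernel is contained in `ker P'`, and it loses `x`.
    refine ⟨β + Matrix.single j i 1, ?_⟩
    have key : ∀ y, (P + Q * (β + Matrix.single j i 1) * U) *ᵥ y
        = P' *ᵥ y + (U *ᵥ y) i • Q.col j := by
      intro y
      rw [Matrix.mul_add, Matrix.add_mul, ← add_assoc, ← hP', Matrix.add_mulVec]
      congr 1
      rw [← Matrix.mulVec_mulVec, ← Matrix.mulVec_mulVec, Matrix.single_mulVec, one_mul]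
      exact (Matrix.mulVec_single Q j _).trans (by ext; simp [mul_comm])
    have hlt : LinearMap.ker (P + Q * (β + Matrix.single j i 1) * U).mulVecLin
        < LinearMap.ker P'.mulVecLin := by
      refine lt_of_le_of_ne ?_ ?_
      · intro y hy
        have hy' : P' *ᵥ y + (U *ᵥ y) i • Q.col j = 0 := (key y).symm.trans hy
        have h0 : (U *ᵥ y) i = 0 := by
          by_contra h0
          apply hj
          refine ⟨-((U *ᵥ y) i)⁻¹ • y, ?_⟩
          rw [map_smul, Matrix.mulVecLin_apply, eq_neg_of_add_eq_zero_left hy']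
          simp [smul_smul, h0]
        rw [h0, zero_smul, add_zero] at hy'
        exact hy'
      · intro heq
        have hx' : x ∈ LinearMap.ker P'.mulVecLin := hx
        rw [← heq] at hx'
        have hx2 : P' *ᵥ x + (U *ᵥ x) i • Q.col j = 0 := (key x).symm.trans hx'
        rw [hx, zero_add] at hx2
        rcases smul_eq_zero.1 hx2 with h0 | h0
        · exact hi h0
        · exact hj (by rw [h0]; exact zero_mem _)
    have h1 := Submodule.finrank_lt_finrank_of_lt hlt
    have h2 := LinearMap.finrank_range_add_finrank_ker P'.mulVecLin
    have h3 := LinearMap.finrank_range_add_finrank_ker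
      (P + Q * (β + Matrix.single j i 1) * U).mulVecLin
    rw [Matrix.rank] at hβ ⊢
    omega

/-- Over an infinite field, finitely many rank conditions on `P + Q β U` that can be met one at a
time can be met simultaneously. -/
theorem Matrix.exists_forall_le_rank_add_mul_mul [Infinite K] {ι : Type*} (s : Finset ι)
    (P Q U : ι → Matrix m n K) (R : ℕ)
    (h : ∀ j ∈ s, ∃ β : Matrix n m K, R ≤ (P j + Q j * β * U j).rank) :
    ∃ β : Matrix n m K, ∀ j ∈ s, R ≤ (P j + Q j * β * U j).rank := by
  classical
  have hp : ∀ j ∈ s, ∃ p : MvPolynomial (n × m) K, p ≠ 0 ∧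
      ∀ β : Matrix n m K, MvPolynomial.eval (fun x => β x.1 x.2) p ≠ 0 →
        R ≤ (P j + Q j * β * U j).rank := by
    intro j hj
    obtain ⟨β, hβ⟩ := h j hj
    obtain ⟨a, b, hab⟩ := (Matrix.le_rank_iff_exists_mul_mul_eq_one _ _).1 hβ
    -- The minor that certifies rank `R` at `β`, taken at a matrix of indeterminates, is a nonzero
    -- polynomial; the product of these over `s` has a nonzero value since `K` is infinite.
    let X : Matrix n m (MvPolynomial (n × m) K) := Matrix.of fun x y => MvPolynomial.X (x, y)
    let C : K →+* MvPolynomial (n × m) K := MvPolynomial.C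
    let p := (a.map C * ((P j).map C + (Q j).map C * X * (U j).map C) * b.map C).det
    have heval : ∀ β : Matrix n m K, MvPolynomial.eval (fun x => β x.1 x.2) p
        = (a * (P j + Q j * β * U j) * b).det := by
      intro β
      have hX : X.map (MvPolynomial.eval fun x : n × m => β x.1 x.2) = β := by
        ext x y
        simp [X]
      rw [RingHom.map_det]
      congr 1
      rw [RingHom.mapMatrix_apply, Matrix.map_mul, Matrix.map_mul,
        Matrix.map_add _ (map_add _), Matrix.map_mul, Matrix.map_mul, hX]
      simp only [Matrix.map_map]
      congr 1 <;> [congr 1; skip] <;> ext x y <;> simp [C, Matrix.mul_apply]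
    refine ⟨p, ?_, ?_⟩
    · intro hp0
      have h1 := heval β
      rw [hp0, map_zero, hab, Matrix.det_one] at h1
      exact zero_ne_one h1
    · intro β' hβ'
      rw [heval] at hβ'
      have h1 := Matrix.rank_of_isUnit _
        ((Matrix.isUnit_iff_isUnit_det _).2 (isUnit_iff_ne_zero.2 hβ'))
      rw [Fintype.card_fin] at h1
      rw [← h1]
      exact (Matrix.rank_mul_le_left _ _).trans (Matrix.rank_mul_le_right _ _)
  choose! p hp0 hp using hp
  have hprod : ∏ j ∈ s, p j ≠ 0 := Finset.prod_ne_zero_iff.2 hp0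
  obtain ⟨x, hx⟩ : ∃ x, MvPolynomial.eval x (∏ j ∈ s, p j) ≠ 0 := by
    by_contra! hcon
    exact hprod (MvPolynomial.funext fun x => by rw [hcon, map_zero])
  rw [map_prod, Finset.prod_ne_zero_iff] at hx
  exact ⟨Matrix.of fun i j => x (i, j), fun j hj => hp j hj _ (hx j hj)⟩

/-- Moving one column of a matrix along an affine combination moves the determinant along it. -/
theorem Matrix.det_add_smul_sub_of_col [DecidableEq n] (M M' M'' : Matrix n n K) (j : n)
    (h' : ∀ p q, q ≠ j → M' p q = M p q) (h'' : ∀ p q, q ≠ j → M'' p q = M p q) (t : K) :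
    (M + t • (M' - M'')).det = M.det + t * (M'.det - M''.det) := by
  have e' : M' = M.updateCol j (M'.col j) := by
    ext p q
    by_cases hq : q = j
    · subst hq; simp
    · simp [hq, h' p q hq]
  have e'' : M'' = M.updateCol j (M''.col j) := by
    ext p q
    by_cases hq : q = j
    · subst hq; simp
    · simp [hq, h'' p q hq]
  have e : M + t • (M' - M'') = M.updateCol j (M.col j + t • (M'.col j + (-1 : K) • M''.col j)) := by
    ext p q
    by_cases hq : q = j
    · subst hq; simp [sub_eq_add_neg]
    · simp [hq, h' p q hq, h'' p q hq]
  rw [e, Matrix.det_updateCol_add, Matrix.det_updateCol_smul, Matrix.det_updateCol_add,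
    Matrix.det_updateCol_smul, ← e', ← e'']
  have e0 : M.updateCol j (M.col j) = M := by
    ext p q
    by_cases hq : q = j
    · subst hq; simp
    · simp [hq]
  rw [e0]
  ring

end LinearAlgebra

/-! ### Functions affine in groups of variables -/

section Affine

variable {X F : Type*} [Field F]

/-- `h` is an affine function of the variables in `s` jointly. -/
def AffineIn (s : Set X) (h : (X → F) → F) : Prop :=
  ∀ (c c' c'' : X → F) (t : F), (∀ v, v ∉ s → c' v = c v) → (∀ v, v ∉ s → c'' v = c v) →
    h (c + t • (c' - c'')) = h c + t * (h c' - h c'')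

theorem AffineIn.mono {s s' : Set X} {h : (X → F) → F} (hh : AffineIn s h) (hs : s' ⊆ s) :
    AffineIn s' h :=
  fun c c' c'' t h1 h2 =>
    hh c c' c'' t (fun v hv => h1 v fun hv' => hv (hs hv')) fun v hv => h2 v fun hv' => hv (hs hv')

/-- A function that is affine in each variable and does not vanish identically does not vanish
at some point with coordinates in `{0, 1}`. -/
theorem exists_zero_one_ne_zero [Finite X] (h : (X → F) → F)
    (hh : ∀ v, AffineIn {v} h) (c : X → F) (hc : h c ≠ 0) :
    ∃ c' : X → F, (∀ v, c' v = 0 ∨ c' v = 1) ∧ h c' ≠ 0 := by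
  classical
  have := Fintype.ofFinite X
  suffices H : ∀ s : Finset X, ∃ c' : X → F, (∀ v ∈ s, c' v = 0 ∨ c' v = 1) ∧ h c' ≠ 0 by
    obtain ⟨c', h1, h2⟩ := H Finset.univ
    exact ⟨c', fun v => h1 v (Finset.mem_univ v), h2⟩
  intro s
  induction s using Finset.induction_on with
  | empty => exact ⟨c, by simp, hc⟩
  | insert v s hv ih =>
    obtain ⟨c', h1, h2⟩ := ih
    -- The value at `c'` is an affine combination of the values with coordinate `v` set to `0` and
    -- to `1`, so these two cannot both vanish.
    have key := hh v (Function.update c' v 0) (Function.update c' v 1) (Function.update c' v 0)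
      (c' v) (fun w hw => by simp [Function.update_of_ne (show w ≠ v from hw)])
      (fun w hw => by simp [Function.update_of_ne (show w ≠ v from hw)])
    have e : Function.update c' v 0 + c' v • (Function.update c' v 1 - Function.update c' v 0)
        = c' := by
      funext w
      by_cases hw : w = v
      · subst hw; simp
      · simp [hw]
    rw [e] at key
    have hx : ∃ x : F, (x = 0 ∨ x = 1) ∧ h (Function.update c' v x) ≠ 0 := by
      by_contra! hcon
      rw [hcon 0 (Or.inl rfl), hcon 1 (Or.inr rfl)] at key
      exact h2 (by rw [key]; ring)
    obtain ⟨x, hx, hne⟩ := hx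
    refine ⟨Function.update c' v x, fun w hw => ?_, hne⟩
    by_cases hwv : w = v
    · subst hwv; simpa using hx
    · rw [Function.update_of_ne hwv]
      exact h1 w ((Finset.mem_insert.1 hw).resolve_left hwv)

end Affine

/-! ### Counting common nonzeros -/

section Counting

variable {X F : Type*} [Fintype X] [Fintype F]

open Classical in
/-- The functions that agree with `c₀` outside `s`. -/
noncomputable def agreeOff (s : Set X) (c₀ : X → F) : Finset (X → F) :=
  Finset.univ.filter fun c => ∀ v, v ∉ s → c v = c₀ v

theorem mem_agreeOff {s : Set X} {c₀ c : X → F} :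
    c ∈ agreeOff s c₀ ↔ ∀ v, v ∉ s → c v = c₀ v := by
  simp [agreeOff]

theorem card_agreeOff_pos (s : Set X) (c₀ : X → F) : 0 < (agreeOff s c₀).card :=
  Finset.card_pos.2 ⟨c₀, mem_agreeOff.2 fun _ _ => rfl⟩

-- Drawing the variables of `s ∪ t` amounts to drawing those of `s` first and then those of `t`: the
-- fibres of the projection that forgets `t` are the sets `agreeOff t x`.
open Classical in
theorem card_filter_agreeOff_union {s t : Set X} (hst : Disjoint s t) (c₀ : X → F)
    (p : (X → F) → Prop) [DecidablePred p] :
    ((agreeOff (s ∪ t) c₀).filter p).card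
      = ∑ x ∈ agreeOff s c₀, ((agreeOff t x).filter p).card := by
  let f : (X → F) → (X → F) := fun c => s.piecewise c c₀
  rw [Finset.card_eq_sum_card_fiberwise (f := f) (t := agreeOff s c₀)]
  · refine Finset.sum_congr rfl fun x hx => congrArg Finset.card ?_
    ext c
    simp only [Finset.mem_filter, mem_agreeOff] at hx ⊢
    constructor
    · rintro ⟨⟨h1, h2⟩, rfl⟩
      refine ⟨fun v hv => ?_, h2⟩
      by_cases hs : v ∈ s
      · simp [f, hs]
      · simp [f, hs, h1 v (by simp [hs, hv])]
    · rintro ⟨h1, h2⟩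
      refine ⟨⟨fun v hv => ?_, h2⟩, ?_⟩
      · rw [Set.mem_union, not_or] at hv
        rw [h1 v hv.2, hx v hv.1]
      · funext v
        by_cases hs : v ∈ s
        · simp [f, hs, h1 v (Set.disjoint_left.1 hst hs)]
        · simp [f, hs, hx v hs]
  · intro c _
    simp only [Finset.mem_coe, mem_agreeOff]
    intro v hv
    simp [f, hv]

variable [Field F]

theorem card_agreeOff_eq (s : Set X) (c₀ c₁ : X → F) :
    (agreeOff s c₀).card = (agreeOff s c₁).card := by
  refine Finset.card_equiv (Equiv.addRight (c₁ - c₀)) fun c => ?_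
  simp only [mem_agreeOff, Equiv.coe_addRight, Pi.add_apply, Pi.sub_apply]
  refine forall₂_congr fun v _ => ?_
  constructor
  · intro h; rw [h]; ring
  · intro h; linear_combination h

open Classical in
/-- An affine function that does not vanish identically vanishes on at most a `1 / q` fraction. -/
theorem card_mul_card_zeros_le {s : Set X} {h : (X → F) → F} (hh : AffineIn s h) (c₀ c₁ : X → F)
    (h₁ : c₁ ∈ agreeOff s c₀) (hne : h c₁ ≠ 0) :
    Fintype.card F * ((agreeOff s c₀).filter fun c => h c = 0).card ≤ (agreeOff s c₀).card := by
  rcases ((agreeOff s c₀).filter fun c => h c = 0).eq_empty_or_nonempty with he | ⟨c₂, h₂⟩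
  · rw [he]; simp
  rw [Finset.mem_filter] at h₂
  obtain ⟨h₂, hz⟩ := h₂
  rw [← Finset.card_univ, ← Finset.card_product]
  have hval : ∀ (t : F) (c : X → F), c ∈ agreeOff s c₀ → h c = 0 →
      h (c + t • (c₁ - c₂)) = t * h c₁ := by
    intro t c hc hc0
    rw [mem_agreeOff] at hc h₁ h₂
    rw [hh c c₁ c₂ t (fun v hv => by rw [h₁ v hv, hc v hv]) (fun v hv => by rw [h₂ v hv, hc v hv]),
      hc0, hz]
    ring
  -- Translating a zero `c` by `t • (c₁ - c₂)`, with `c₂` a zero, gives a point of value `t * h c₁`.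
  -- The value determines `t`, and then the point determines `c`.
  refine Finset.card_le_card_of_injOn (fun p => p.2 + p.1 • (c₁ - c₂)) ?_ ?_
  · rintro ⟨t, c⟩ hp
    simp only [Finset.coe_product, Set.mem_prod, Finset.mem_coe, Finset.mem_filter] at hp
    have hc := hp.2.1
    rw [mem_agreeOff] at hc h₁ h₂
    simp only [Finset.mem_coe, mem_agreeOff]
    intro v hv
    simp [hc v hv, h₁ v hv, h₂ v hv]
  · rintro ⟨t, c⟩ hp ⟨t', c'⟩ hp' heq
    simp only [Finset.coe_product, Set.mem_prod, Finset.mem_coe, Finset.mem_filter] at hp hp' heq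
    have h1 := hval t c hp.2.1 hp.2.2
    have h2 := hval t' c' hp'.2.1 hp'.2.2
    rw [heq, h2] at h1
    have htt : t = t' := (mul_right_cancel₀ hne h1).symm
    subst htt
    exact Prod.ext rfl (add_right_cancel heq)

set_option maxHeartbeats 400000 in
open Classical in
/-- Let `N` functions be affine in each of several groups of variables, and let each of them be
nonzero somewhere. Then all of them are nonzero with probability at least `(1 - N / q) ^ a`,
where `a` is the number of groups. The variables of no group are irrelevant. -/
theorem pow_mul_card_le_card_filter_ne_zero {κ : Type*} {N : ℕ} (hN : N ≤ Fintype.card F)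
    (grp : X → Option κ) (h : Fin N → (X → F) → F)
    (hh : ∀ i k, AffineIn {v | grp v = some k} (h i))
    (hnone : ∀ i c c', (∀ v, grp v ≠ none → c v = c' v) → h i c ≠ 0 → h i c' ≠ 0)
    (J : Set X) (A : Finset κ) (c₀ : X → F)
    (hne : ∀ i, ∃ c ∈ agreeOff {v ∈ J | ∀ k, grp v = some k → k ∈ A} c₀, h i c ≠ 0) :
    (1 - (N : ℝ) / Fintype.card F) ^ A.card *
        (agreeOff {v ∈ J | ∀ k, grp v = some k → k ∈ A} c₀).card ≤
      ((agreeOff {v ∈ J | ∀ k, grp v = some k → k ∈ A} c₀).filter fun c => ∀ i, h i c ≠ 0).card := by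
  have hq : (0 : ℝ) < Fintype.card F := by exact_mod_cast Fintype.card_pos
  have hp0 : 0 ≤ 1 - (N : ℝ) / Fintype.card F := by
    rw [sub_nonneg, div_le_one hq]
    exact_mod_cast hN
  induction A using Finset.induction_on generalizing c₀ with
  | empty =>
    rw [Finset.filter_true_of_mem]
    · simp
    · intro c hc i
      obtain ⟨c', hc', hn⟩ := hne i
      refine hnone i c' c (fun v hv => ?_) hn
      rw [mem_agreeOff] at hc hc'
      obtain ⟨k, hk⟩ := Option.ne_none_iff_exists'.1 hv
      have hv' : v ∉ {v ∈ J | ∀ k, grp v = some k → k ∈ (∅ : Finset κ)} := by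
        rintro ⟨-, h2⟩
        exact absurd (h2 k hk) (Finset.notMem_empty k)
      rw [hc v hv', hc' v hv']
  | insert k A hk ih =>
    set s : Set X := {v ∈ J | grp v = some k} with hs
    set t : Set X := {v ∈ J | ∀ k, grp v = some k → k ∈ A} with ht
    have hst : Disjoint s t := by
      rw [Set.disjoint_left]
      rintro v ⟨-, h1⟩ ⟨-, h2⟩
      exact hk (h2 k h1)
    have hunion : {v ∈ J | ∀ l, grp v = some l → l ∈ insert k A} = s ∪ t := by
      ext v
      simp only [hs, ht, Set.mem_ofPred_eq, Set.mem_union, Finset.mem_insert]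
      constructor
      · rintro ⟨hJ, h1⟩
        by_cases hv : grp v = some k
        · exact Or.inl ⟨hJ, hv⟩
        · exact Or.inr ⟨hJ, fun l hl => (h1 l hl).resolve_left fun e => hv (e ▸ hl)⟩
      · rintro (⟨hJ, h1⟩ | ⟨hJ, h1⟩)
        · refine ⟨hJ, fun l hl => Or.inl ?_⟩
          rw [h1] at hl
          exact (Option.some.inj hl).symm
        · exact ⟨hJ, fun l hl => Or.inr (h1 l hl)⟩
    rw [hunion] at hne ⊢
    choose w hw hwne using hne
    -- The group `k` is drawn first. An outcome `x` is live if each `h i` can still be made nonzero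
    -- by the remaining variables. The witness `w i` certifies this for `h i` unless `x` falls into
    -- `dead i`, the zero set of one affine function of `x`.
    let live : Finset (X → F) := (agreeOff s c₀).filter fun x => ∀ i, ∃ c ∈ agreeOff t x, h i c ≠ 0
    let dead : Fin N → Finset (X → F) := fun i =>
      (agreeOff s c₀).filter fun x => h i (s.piecewise x (w i)) = 0
    have hdead : ∀ i, Fintype.card F * (dead i).card ≤ (agreeOff s c₀).card := by
      intro i
      refine card_mul_card_zeros_le (h := fun x => h i (s.piecewise x (w i))) ?_ c₀
        (s.piecewise (w i) c₀) ?_ ?_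
      · intro c c' c'' x h1 h2
        have e : s.piecewise (c + x • (c' - c'')) (w i)
            = s.piecewise c (w i) + x • (s.piecewise c' (w i) - s.piecewise c'' (w i)) := by
          funext v
          by_cases hv : v ∈ s <;> simp [hv]
        simp only [e]
        refine ((hh i k).mono (s' := s) fun v hv => hv.2) _ _ _ x ?_ ?_ <;>
        · intro v hv
          simp [hv]
      · rw [mem_agreeOff]
        intro v hv
        simp [hv]
      · have e : s.piecewise (s.piecewise (w i) c₀) (w i) = w i := by
          funext v
          by_cases hv : v ∈ s <;> simp [hv]
        simp only [e]
        exact hwne i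
    have hcover : agreeOff s c₀ ⊆ live ∪ Finset.univ.biUnion dead := by
      intro x hx
      rw [Finset.mem_union, Finset.mem_biUnion]
      by_cases hd : ∃ i, x ∈ dead i
      · obtain ⟨i, hi⟩ := hd
        exact Or.inr ⟨i, Finset.mem_univ i, hi⟩
      · left
        refine Finset.mem_filter.2 ⟨hx, fun i => ⟨s.piecewise x (w i), ?_, fun h0 => hd ⟨i, ?_⟩⟩⟩
        · rw [mem_agreeOff]
          intro v hv
          by_cases hvs : v ∈ s
          · simp [hvs]
          · have h1 := mem_agreeOff.1 (hw i) v (by simp [hvs, hv])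
            simp [hvs, h1, mem_agreeOff.1 hx v hvs]
        · exact Finset.mem_filter.2 ⟨hx, h0⟩
    have hlive : (1 - (N : ℝ) / Fintype.card F) * (agreeOff s c₀).card ≤ live.card := by
      have h1 : (agreeOff s c₀).card ≤ live.card + ∑ i, (dead i).card :=
        (Finset.card_le_card hcover).trans
          ((Finset.card_union_le _ _).trans (Nat.add_le_add_left Finset.card_biUnion_le _))
      have h2 : ∀ i, ((dead i).card : ℝ) ≤ (agreeOff s c₀).card / Fintype.card F := by
        intro i
        rw [le_div_iff₀ hq, mul_comm]
        exact_mod_cast hdead i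
      have h3 : (∑ i, ((dead i).card : ℝ)) ≤ N * ((agreeOff s c₀).card / Fintype.card F) := by
        refine (Finset.sum_le_sum fun i _ => h2 i).trans ?_
        simp
      have h4 : ((agreeOff s c₀).card : ℝ) ≤ live.card + ∑ i, ((dead i).card : ℝ) := by
        exact_mod_cast h1
      have h5 : (1 - (N : ℝ) / Fintype.card F) * (agreeOff s c₀).card
          = (agreeOff s c₀).card - N * ((agreeOff s c₀).card / Fintype.card F) := by ring
      linarith
    have hcard : ((agreeOff (s ∪ t) c₀).card : ℝ)
        = (agreeOff s c₀).card * (agreeOff t c₀).card := by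
      have h1 := card_filter_agreeOff_union hst c₀ fun _ => True
      simp only [Finset.filter_true] at h1
      rw [h1, Finset.sum_congr rfl fun x _ => card_agreeOff_eq t x c₀, Finset.sum_const]
      simp
    have hgood := card_filter_agreeOff_union hst c₀ fun c => ∀ i, h i c ≠ 0
    have hsum : ∑ x ∈ live, ((1 - (N : ℝ) / Fintype.card F) ^ A.card * (agreeOff t c₀).card) ≤
        ((agreeOff (s ∪ t) c₀).filter fun c => ∀ i, h i c ≠ 0).card := by
      rw [hgood, Nat.cast_sum]
      have hsub : live ⊆ agreeOff s c₀ := Finset.filter_subset _ _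
      refine le_trans ?_ (Finset.sum_le_sum_of_subset_of_nonneg hsub
        fun _ _ _ => Nat.cast_nonneg _)
      refine Finset.sum_le_sum fun x hx => ?_
      rw [card_agreeOff_eq t c₀ x]
      exact ih x (Finset.mem_filter.1 hx).2
    refine le_trans ?_ hsum
    rw [Finset.sum_const, nsmul_eq_mul, hcard, Finset.card_insert_of_notMem hk, pow_succ]
    have := mul_le_mul_of_nonneg_right hlive
      (mul_nonneg (pow_nonneg hp0 A.card) (Nat.cast_nonneg (agreeOff t c₀).card))
    refine le_trans (le_of_eq ?_) this
    ring

end Counting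

/-- A nonzero entry of the `k`-th power comes from a chain of `k` steps, along which `b` increases
by at least `k`; but `b` is bounded. -/
theorem Matrix.isNilpotent_of_lt {n K : Type*} [Fintype n] [DecidableEq n] [CommRing K]
    (A : Matrix n n K) (b : n → ℕ) (hA : ∀ p p', A p p' ≠ 0 → b p < b p') : IsNilpotent A := by
  have hpow : ∀ (k : ℕ) (p p' : n), (A ^ k) p p' ≠ 0 → b p + k ≤ b p' := by
    intro k
    induction k with
    | zero =>
      intro p p' h
      rw [pow_zero, Matrix.one_apply] at h
      have : p = p' := by
        by_contra hne
        simp [hne] at h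
      simp [this]
    | succ k ih =>
      intro p p' h
      rw [pow_succ, Matrix.mul_apply] at h
      obtain ⟨x, -, hx⟩ := Finset.exists_ne_zero_of_sum_ne_zero h
      have h1 := ih p x (left_ne_zero_of_mul hx)
      have h2 := hA x p' (right_ne_zero_of_mul hx)
      omega
  refine ⟨Finset.univ.sup b + 1, ?_⟩
  ext p p'
  by_contra h
  have h1 := hpow _ p p' h
  have h2 : b p' ≤ Finset.univ.sup b := Finset.le_sup (Finset.mem_univ p')
  omega

/-! ### The network equations as one block matrix -/

namespace ADTNetwork

variable {V I O : Type*} {G : ADTNetwork V I O} {S : V} {N : ℕ} {T : Fin N → V} {R : ℕ}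

/-- The supernodes of an acyclic network can be numbered along the links. -/
theorem Acyclic.exists_lt_of_link [Finite V] (hG : G.Acyclic) :
    ∃ ρ : V → ℕ, ∀ v w, G.Link v w → ρ v < ρ w := by
  refine ⟨fun w => {v | Relation.TransGen G.Link v w}.ncard, fun v w h => ?_⟩
  refine Set.ncard_lt_ncard ?_ (Set.toFinite _)
  exact (Set.ssubset_iff_of_subset fun u (hu : Relation.TransGen G.Link u v) =>
    Relation.TransGen.tail hu h).2 ⟨v, Relation.TransGen.single h, hG v⟩

/-- The output port whose coefficients include a given `α` or `β`. -/
def CodeVar.output : G.CodeVar S T R → Option O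
  | Sum.inl p => some p.2.1
  | Sum.inr (Sum.inl p) => some p.1.2
  | Sum.inr (Sum.inr _) => none

section Matrices

variable {F : Type*} [Field F] [DecidableEq V] [DecidableEq I] [DecidableEq O]

/-- The system matrix of the network equations for the ports and the outputs of `T i`. -/
def portMatrix (c : G.CodeVar S T R → F) (i : Fin N) :
    Matrix ((I ⊕ O) ⊕ Fin R) ((I ⊕ O) ⊕ Fin R) F :=
  Matrix.fromBlocks (1 - adjMatrix c) (decMatrix c i)ᵀ (encMatrix c) 0

theorem portMatrix_add_smul_sub (c c' c'' : G.CodeVar S T R → F) (t : F) (i : Fin N) :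
    portMatrix (c + t • (c' - c'')) i
      = portMatrix c i + t • (portMatrix c' i - portMatrix c'' i) := by
  ext p q
  rcases p with (p | p) | p <;> rcases q with (q | q) | q <;>
    simp only [portMatrix, adjMatrix, encMatrix, decMatrix, Matrix.fromBlocks_apply₁₁,
      Matrix.fromBlocks_apply₁₂, Matrix.fromBlocks_apply₂₁, Matrix.fromBlocks_apply₂₂,
      Matrix.add_apply, Matrix.smul_apply, Matrix.sub_apply, Matrix.transpose_apply,
      Matrix.of_apply, Matrix.zero_apply, Pi.add_apply, Pi.smul_apply, Pi.sub_apply,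
      smul_eq_mul] <;>
    (try split_ifs) <;> ring

theorem portMatrix_map {K : Type*} [Field K] [Algebra F K] (c : G.CodeVar S T R → F)
    (i : Fin N) :
    portMatrix (fun v => algebraMap F K (c v)) i = (portMatrix c i).map (algebraMap F K) := by
  ext p q
  rcases p with (p | p) | p <;> rcases q with (q | q) | q <;>
    simp only [portMatrix, adjMatrix, encMatrix, decMatrix, Matrix.fromBlocks_apply₁₁,
      Matrix.fromBlocks_apply₁₂, Matrix.fromBlocks_apply₂₁, Matrix.fromBlocks_apply₂₂,
      Matrix.sub_apply, Matrix.transpose_apply, Matrix.map_apply, Matrix.one_apply,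
      Matrix.of_apply, Matrix.zero_apply] <;>
    (try split_ifs) <;> simp

/-- The coefficients of the port `e` occur in column `e` only. -/
theorem portMatrix_apply_congr_of_output (c c' : G.CodeVar S T R → F) (i : Fin N) (e : O)
    (h : ∀ v, v.output ≠ some e → c v = c' v) (p q : (I ⊕ O) ⊕ Fin R)
    (hq : q ≠ Sum.inl (Sum.inr e)) : portMatrix c i p q = portMatrix c' i p q := by
  rcases p with (p | p) | p <;> rcases q with (q | q) | q <;>
    simp only [portMatrix, adjMatrix, encMatrix, decMatrix, Matrix.fromBlocks_apply₁₁,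
      Matrix.fromBlocks_apply₁₂, Matrix.fromBlocks_apply₂₁, Matrix.fromBlocks_apply₂₂,
      Matrix.sub_apply, Matrix.transpose_apply, Matrix.of_apply]
  · split_ifs
    · rw [h _ (by simpa [CodeVar.output] using hq)]
    · rfl
  · split_ifs
    · rw [h _ (by simp [CodeVar.output])]
    · rfl
  · split_ifs
    · rw [h _ (by simpa [CodeVar.output] using hq)]
    · rfl

/-- The coefficients of the output process `k` of `T i` occur in column `k` only. -/
theorem portMatrix_apply_congr_of_eps (c c' : G.CodeVar S T R → F) (i : Fin N) (k : Option (Fin R))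
    (hαβ : ∀ v, v.output ≠ none → c v = c' v)
    (hε : ∀ e' l, some l ≠ k → c (CodeVar.ε i e' l) = c' (CodeVar.ε i e' l))
    (p q : (I ⊕ O) ⊕ Fin R) (hq : some q ≠ k.map Sum.inr) :
    portMatrix c i p q = portMatrix c' i p q := by
  rcases p with (p | p) | p <;> rcases q with (q | q) | q <;>
    simp only [portMatrix, adjMatrix, encMatrix, decMatrix, Matrix.fromBlocks_apply₁₁,
      Matrix.fromBlocks_apply₁₂, Matrix.fromBlocks_apply₂₁, Matrix.fromBlocks_apply₂₂,
      Matrix.sub_apply, Matrix.transpose_apply, Matrix.of_apply]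
  · split_ifs
    · rw [hαβ _ (by simp [CodeVar.output])]
    · rfl
  · split_ifs
    · refine hε _ _ ?_
      rintro rfl
      exact hq rfl
    · rfl
  · split_ifs
    · rw [hαβ _ (by simp [CodeVar.output])]
    · rfl

variable [Fintype I] [Fintype O]

/-- A function of the code that changes one column of `portMatrix` is affine. -/
theorem affineIn_det_portMatrix (i : Fin N) (s : Set (G.CodeVar S T R))
    (f : (G.CodeVar S T R → F) → G.CodeVar S T R → F)
    (hf : ∀ c c' c'' (t : F), f (c + t • (c' - c'')) = f c + t • (f c' - f c''))
    (j : Option ((I ⊕ O) ⊕ Fin R))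
    (h : ∀ c c', (∀ v, v ∉ s → c' v = c v) →
      ∀ p q, some q ≠ j → portMatrix (f c') i p q = portMatrix (f c) i p q) :
    AffineIn s fun c => (portMatrix (f c) i).det := by
  intro c c' c'' t h' h''
  simp only [hf, portMatrix_add_smul_sub]
  have e' := h c c' h'
  have e'' := h c c'' h''
  cases j with
  | none =>
    have e1 : portMatrix (f c') i = portMatrix (f c) i := by
      ext p q; exact e' p q (by simp)
    have e2 : portMatrix (f c'') i = portMatrix (f c) i := by
      ext p q; exact e'' p q (by simp)
    simp [e1, e2]
  | some j =>
    exact Matrix.det_add_smul_sub_of_col _ _ _ j (fun p q hq => e' p q (by simpa using hq))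
      (fun p q hq => e'' p q (by simpa using hq)) t

/-- Acyclicity makes the adjacency matrix nilpotent. -/
theorem Acyclic.isUnit_one_sub_adjMatrix [Finite V] (hG : G.Acyclic) (c : G.CodeVar S T R → F) :
    IsUnit (1 - adjMatrix c) := by
  obtain ⟨ρ, hρ⟩ := hG.exists_lt_of_link
  refine IsNilpotent.isUnit_one_sub (Matrix.isNilpotent_of_lt _
    -- Doubling `ρ` makes room for the input ports of a supernode to precede its output ports.
    (Sum.elim (fun e' => 2 * ρ (G.inNode e')) fun e => 2 * ρ (G.outNode e) + 1) ?_)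
  rintro (p | p) (q | q) h
  · exact absurd rfl h
  · simp only [adjMatrix, Matrix.of_apply] at h
    split_ifs at h with hpq
    · simp [hpq]
    · exact absurd rfl h
  · simp only [adjMatrix, Matrix.of_apply] at h
    split_ifs at h with hpq
    · have : ρ (G.outNode p) < ρ (G.inNode q) := hρ _ _ ⟨_, hpq, rfl, rfl⟩
      simp only [Sum.elim_inl, Sum.elim_inr]
      omega
    · exact absurd rfl h
  · exact absurd rfl h

/-- Up to sign, `M i` is the Schur complement of the invertible block `1 - F`. -/
theorem Acyclic.isUnit_systemMatrix_iff [Finite V] (hG : G.Acyclic) (c : G.CodeVar S T R → F)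
    (i : Fin N) : IsUnit (systemMatrix c i) ↔ (portMatrix c i).det ≠ 0 := by
  have hu := hG.isUnit_one_sub_adjMatrix c
  have := hu.invertible
  rw [portMatrix, Matrix.det_fromBlocks₁₁, zero_sub, Matrix.invOf_eq_nonsing_inv, Matrix.det_neg,
    Matrix.isUnit_iff_isUnit_det, isUnit_iff_ne_zero, systemMatrix]
  have h1 : (1 - adjMatrix c).det ≠ 0 :=
    isUnit_iff_ne_zero.1 ((Matrix.isUnit_iff_isUnit_det _).1 hu)
  simp [h1]

/-- The coefficients of output ports without an edge do not matter. -/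
theorem Acyclic.systemMatrix_congr [Finite V] (hG : G.Acyclic) (c c' : G.CodeVar S T R → F)
    (i : Fin N)
    (h : ∀ v : G.CodeVar S T R, (∀ e, v.output = some e → ∃ e', (e, e') ∈ G.edges) → c v = c' v) :
    systemMatrix c i = systemMatrix c' i := by
  have hu := (Matrix.isUnit_iff_isUnit_det _).1 (hG.isUnit_one_sub_adjMatrix c)
  have hu' := (Matrix.isUnit_iff_isUnit_det _).1 (hG.isUnit_one_sub_adjMatrix c')
  set W := (1 - adjMatrix c)⁻¹ * (decMatrix c i)ᵀ with hW
  have hWeq : W = adjMatrix c * W + (decMatrix c i)ᵀ := by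
    have : (1 - adjMatrix c) * W = (decMatrix c i)ᵀ := Matrix.mul_nonsing_inv_cancel_left _ _ hu
    rw [← this, Matrix.sub_mul, Matrix.one_mul]
    abel
  have hdec : decMatrix c' i = decMatrix c i := by
    ext k p
    rcases p with p | p <;> simp only [decMatrix, Matrix.of_apply]
    split_ifs
    · exact (h _ fun e he => by simp [CodeVar.output] at he).symm
    · rfl
  -- Row `p` of `W` tells how the symbol at port `p` enters the outputs. It vanishes at a port
  -- without edges, so the columns of `F` and `A` at such a port have no effect on `F * W` and `A *
  -- W`.
  have hdead : ∀ e k, (¬ ∃ e', (e, e') ∈ G.edges) → W (Sum.inr e) k = 0 := by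
    intro e k he
    have hadj : ∀ p, adjMatrix c (Sum.inr e) p = 0 := by
      rintro (p | p) <;> simp only [adjMatrix, Matrix.of_apply]
      rw [if_neg fun hp => he ⟨p, hp⟩]
    rw [hWeq, Matrix.add_apply, Matrix.mul_apply]
    simp [hadj, decMatrix]
  have hadj : adjMatrix c' * W = adjMatrix c * W := by
    ext p k
    simp only [Matrix.mul_apply]
    refine Finset.sum_congr rfl fun x _ => ?_
    rcases x with x | x
    · rcases p with p | p <;> rfl
    · by_cases hx : ∃ e', (x, e') ∈ G.edges
      · congr 1
        rcases p with p | p <;> simp only [adjMatrix, Matrix.of_apply]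
        split_ifs
        · refine (h _ fun e he => ?_).symm
          obtain rfl : x = e := by simpa [CodeVar.output] using he
          exact hx
        · rfl
      · rw [hdead x k hx, mul_zero, mul_zero]
  have henc : encMatrix c' * W = encMatrix c * W := by
    ext p k
    simp only [Matrix.mul_apply]
    refine Finset.sum_congr rfl fun x _ => ?_
    rcases x with x | x
    · rfl
    · by_cases hx : ∃ e', (x, e') ∈ G.edges
      · congr 1
        simp only [encMatrix, Matrix.of_apply]
        split_ifs
        · refine (h _ fun e he => ?_).symm
          obtain rfl : x = e := by simpa [CodeVar.output] using he
          exact hx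
        · rfl
      · rw [hdead x k hx, mul_zero, mul_zero]
  have hW' : (1 - adjMatrix c')⁻¹ * (decMatrix c' i)ᵀ = W := by
    have : (1 - adjMatrix c') * W = (decMatrix c' i)ᵀ := by
      rw [Matrix.sub_mul, hadj, Matrix.one_mul, hdec]
      nth_rewrite 1 [hWeq]
      abel
    rw [← this, Matrix.nonsing_inv_mul_cancel_left _ _ hu']
  rw [systemMatrix, systemMatrix, Matrix.mul_assoc, Matrix.mul_assoc, hW', henc]

end Matrices

end ADTNetwork

/-! ### Serving one destination by eliminating supernodes -/

namespace ADTNetwork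

variable {V I O : Type*} {G : ADTNetwork V I O} {S : V} {N : ℕ} {T : Fin N → V} {R : ℕ}

section Unicast

variable {K : Type*} [Field K] [DecidableEq V]

/-- The incidence matrix between all output ports and all input ports. -/
def edgeMatrix [DecidableEq I] [DecidableEq O] (G : ADTNetwork V I O) (K : Type*) [Field K] :
    Matrix O I K :=
  Matrix.of fun e e' => if (e, e') ∈ G.edges then 1 else 0

/-- The part of a matrix that runs from the output ports in `Ω` to the input ports in `Θ`. -/
def restrictTo (G : ADTNetwork V I O) (Ω Θ : Finset V) (X : Matrix O I K) : Matrix O I K :=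
  Matrix.of fun e e' => if G.outNode e ∈ Ω ∧ G.inNode e' ∈ Θ then X e e' else 0

variable [Fintype I] [Fintype O]

/-- Brings the cuts, after `v` has been given coefficients `β`, into the form `P + Q β U` of the
rank lemmas. -/
theorem restrictTo_add_mul_mul (Ω Θ : Finset V) (v : V) (X : Matrix O I K) (β : Matrix I O K) :
    G.restrictTo Ω Θ (X + X * (Matrix.of fun e' e =>
        if G.inNode e' = v ∧ G.outNode e = v then β e' e else 0) * X)
      = G.restrictTo Ω Θ X + G.restrictTo Ω {v} X * β * G.restrictTo {v} Θ X := by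
  ext e e'
  simp only [restrictTo, Matrix.add_apply, Matrix.of_apply, Matrix.mul_apply]
  by_cases h : G.outNode e ∈ Ω ∧ G.inNode e' ∈ Θ
  · rw [if_pos h, if_pos h]
    congr 1
    refine Finset.sum_congr rfl fun b _ => ?_
    by_cases hb : G.outNode b = v
    · simp only [h.1, h.2, hb, Finset.mem_singleton, true_and, and_true, if_true]
      congr 1
      refine Finset.sum_congr rfl fun a _ => ?_
      by_cases ha : G.inNode a = v <;> simp [ha]
    · simp [hb]
  · rw [if_neg h, if_neg h, zero_add, eq_comm]
    refine Finset.sum_eq_zero fun b _ => ?_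
    rcases not_and_or.1 h with h | h <;> simp [h]

variable [DecidableEq I] [DecidableEq O]

/-- Supernodes can be eliminated one at a time, by fixing their coefficients, without decreasing
the ranks of the cuts below `R`. -/
theorem exists_elimination [Fintype V] [Infinite K] (ρ : V → ℕ)
    (hρ : ∀ v w, G.Link v w → ρ v < ρ w) (S D : V) (R : ℕ)
    (hcut : ∀ Ω : Finset V, S ∈ Ω → D ∉ Ω → R ≤ (G.restrictTo Ω Ωᶜ (G.edgeMatrix K)).rank)
    (U : Finset V) (hS : S ∉ U) (hD : D ∉ U) :
    ∃ (β : Matrix I O K) (X : Matrix O I K),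
      X = G.edgeMatrix K + G.edgeMatrix K * β * X ∧
      (∀ e' e, β e' e ≠ 0 → G.inNode e' = G.outNode e) ∧
      (∀ e e', X e e' ≠ 0 → ρ (G.outNode e) < ρ (G.inNode e')) ∧
      ∀ Ω : Finset V, S ∈ Ω → D ∉ Ω → Disjoint Ω U → R ≤ (G.restrictTo Ω (Ω ∪ U)ᶜ X).rank := by
  induction U using Finset.induction_on with
  | empty =>
    refine ⟨0, G.edgeMatrix K, by simp, by simp, fun e e' h => ?_, fun Ω h1 h2 _ => ?_⟩
    · simp only [edgeMatrix, Matrix.of_apply] at h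
      refine hρ _ _ ⟨(e, e'), ?_, rfl, rfl⟩
      by_contra hcon
      simp [hcon] at h
    · rw [Finset.union_empty]
      exact hcut Ω h1 h2
  | insert v U hv ih =>
    rw [Finset.mem_insert, not_or] at hS hD
    obtain ⟨β, X, hX, hβ, hlt, hrank⟩ := ih hS.2 hD.2
    -- `X` is the transfer matrix along paths whose intermediate supernodes lie in `U`. For a cut
    -- `Ω` of what remains, the hypotheses on `P + Q` and `P + U` of the rank lemma are the old
    -- bounds for `Ω` and for `insert v Ω`.
    obtain ⟨γ, hγ⟩ := Matrix.exists_forall_le_rank_add_mul_mul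
      (Finset.univ.filter fun Ω : Finset V => S ∈ Ω ∧ D ∉ Ω ∧ Disjoint Ω (insert v U))
      (fun Ω => G.restrictTo Ω (Ω ∪ insert v U)ᶜ X) (fun Ω => G.restrictTo Ω {v} X)
      (fun Ω => G.restrictTo {v} (Ω ∪ insert v U)ᶜ X) R (by
        intro Ω hΩ
        obtain ⟨h1, h2, h3⟩ := (Finset.mem_filter.1 hΩ).2
        rw [Finset.disjoint_insert_right] at h3
        refine Matrix.exists_le_rank_add_mul_mul _ _ _ R ?_ ?_
        · refine (hrank Ω h1 h2 h3.2).trans (le_of_eq (congrArg Matrix.rank ?_))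
          ext e e'
          simp only [restrictTo, Matrix.add_apply, Matrix.of_apply, Finset.mem_compl,
            Finset.mem_union, Finset.mem_insert, Finset.mem_singleton]
          by_cases hev : G.inNode e' = v
          · simp [hev, h3.1, hv]
          · simp [hev]
        · have h4 : D ∉ insert v Ω := by
            rw [Finset.mem_insert, not_or]
            exact ⟨hD.1, h2⟩
          refine (hrank (insert v Ω) (Finset.mem_insert_of_mem h1) h4
            (Finset.disjoint_insert_left.2 ⟨hv, h3.2⟩)).trans
            (le_of_eq (congrArg Matrix.rank ?_))
          ext e e'
          simp only [restrictTo, Matrix.add_apply, Matrix.of_apply, Finset.mem_compl,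
            Finset.mem_union, Finset.mem_insert, Finset.mem_singleton]
          by_cases hev : G.outNode e = v
          · simp [hev, h3.1, or_assoc, or_left_comm]
          · simp [hev, or_assoc, or_left_comm])
    set B : Matrix I O K := Matrix.of fun e' e =>
      if G.inNode e' = v ∧ G.outNode e = v then γ e' e else 0 with hBdef
    have hB : ∀ e' e, B e' e ≠ 0 → G.inNode e' = v ∧ G.outNode e = v := by
      intro e' e h
      by_contra hcon
      exact h (if_neg hcon)
    -- No path leads from `v` back to `v`, as `X` only connects to larger `ρ`. So passing through
    -- `v` at most once, as in `X + X * B * X`, accounts for all paths.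
    have hBXB : B * X * B = 0 := by
      ext e' e
      rw [Matrix.mul_apply]
      refine Finset.sum_eq_zero fun a _ => ?_
      rw [Matrix.mul_apply, Finset.sum_mul]
      refine Finset.sum_eq_zero fun b _ => ?_
      by_contra hcon
      have h1 := hB _ _ (left_ne_zero_of_mul (left_ne_zero_of_mul hcon))
      have h2 := hlt _ _ (right_ne_zero_of_mul (left_ne_zero_of_mul hcon))
      have h3 := hB _ _ (right_ne_zero_of_mul hcon)
      rw [h1.2, h3.1] at h2
      exact lt_irrefl _ h2
    refine ⟨β + B, X + X * B * X, ?_, ?_, ?_, ?_⟩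
    · set E := G.edgeMatrix K
      have h1 : E + E * (β + B) * (X + X * B * X)
          = (E + E * β * X) + (E + E * β * X) * B * X + E * (B * X * B) * X := by
        simp only [Matrix.mul_add, Matrix.add_mul, Matrix.mul_assoc]
        abel
      rw [h1, ← hX, hBXB, Matrix.mul_zero, Matrix.zero_mul, add_zero]
    · intro e' e h
      by_cases h0 : β e' e = 0
      · rw [Matrix.add_apply, h0, zero_add] at h
        rw [(hB _ _ h).1, (hB _ _ h).2]
      · exact hβ _ _ h0
    · intro e e' h
      by_cases h0 : X e e' = 0
      · rw [Matrix.add_apply, h0, zero_add, Matrix.mul_apply] at h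
        obtain ⟨a, -, ha⟩ := Finset.exists_ne_zero_of_sum_ne_zero h
        have h3 := hlt _ _ (right_ne_zero_of_mul ha)
        have h' := left_ne_zero_of_mul ha
        rw [Matrix.mul_apply] at h'
        obtain ⟨b, -, hb⟩ := Finset.exists_ne_zero_of_sum_ne_zero h'
        have h1 := hlt _ _ (left_ne_zero_of_mul hb)
        have h2 := hB _ _ (right_ne_zero_of_mul hb)
        rw [h2.1] at h1
        rw [h2.2] at h3
        exact h1.trans h3
      · exact hlt _ _ h0
    · intro Ω h1 h2 h3
      rw [hBdef, restrictTo_add_mul_mul]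
      exact hγ Ω (Finset.mem_filter.2 ⟨Finset.mem_univ _, h1, h2, h3⟩)

theorem exists_systemMatrix_eq_one [Fintype V] [Infinite K] (hG : G.Acyclic) (i : Fin N)
    (hT : T i ≠ S)
    (hcut : ∀ Ω : Finset V, S ∈ Ω → T i ∉ Ω → R ≤ (G.restrictTo Ω Ωᶜ (G.edgeMatrix K)).rank) :
    ∃ c : G.CodeVar S T R → K, systemMatrix c i = 1 := by
  obtain ⟨ρ, hρ⟩ := hG.exists_lt_of_link
  -- Once all supernodes but `S` and `T i` are eliminated, the cut `{S}` is the transfer matrix from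
  -- `O(S)` to `I(T i)`.
  obtain ⟨β, X, hX, hβ, -, hrank⟩ := exists_elimination ρ hρ S (T i) R hcut ({S, T i}ᶜ)
    (by simp) (by simp)
  have h1 := hrank {S} (Finset.mem_singleton_self S) (by simpa using hT) (by simp)
  obtain ⟨a, b, hab⟩ := (Matrix.le_rank_iff_exists_mul_mul_eq_one _ _).1 h1
  let a' : Matrix (Fin R) O K := Matrix.of fun k e => if G.outNode e = S then a k e else 0
  let b' : Matrix I (Fin R) K := Matrix.of fun e' k => if G.inNode e' = T i then b e' k else 0
  have hab' : a' * X * b' = 1 := by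
    rw [← hab]
    ext k l
    simp only [Matrix.mul_apply]
    refine Finset.sum_congr rfl fun e' _ => ?_
    by_cases he' : G.inNode e' = T i
    · simp only [b', Matrix.of_apply, he', if_true]
      congr 1
      refine Finset.sum_congr rfl fun e _ => ?_
      by_cases he : G.outNode e = S <;> simp [a', restrictTo, he, he', hT]
    · simp only [b', Matrix.of_apply, he', if_false, mul_zero]
      rw [Finset.sum_eq_zero, zero_mul]
      intro e _
      by_cases he : G.inNode e' = S <;> simp [restrictTo, he, he']
  let c : G.CodeVar S T R → K := fun v =>
    match v with
    | Sum.inl p => a p.1 p.2.1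
    | Sum.inr (Sum.inl p) => β p.1.1 p.1.2
    | Sum.inr (Sum.inr p) => b p.2.1.1 p.2.2
  have hadj : adjMatrix c = Matrix.fromBlocks 0 β (G.edgeMatrix K) 0 := by
    ext p q
    rcases p with p | p <;> rcases q with q | q <;>
      simp only [adjMatrix, Matrix.of_apply, Matrix.fromBlocks_apply₁₁,
        Matrix.fromBlocks_apply₁₂, Matrix.fromBlocks_apply₂₁, Matrix.fromBlocks_apply₂₂,
        Matrix.zero_apply]
    · split_ifs with h
      · rfl
      · by_contra hcon
        exact h (hβ p q fun h0 => hcon h0.symm)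
    · rfl
  have henc : encMatrix c = Matrix.fromCols 0 a' := by
    ext k p
    rcases p with p | p <;> simp [encMatrix, c, a']
  have hdec : (decMatrix c i)ᵀ = Matrix.fromRows b' 0 := by
    ext p k
    rcases p with p | p <;> simp [decMatrix, c, b']
  -- The port equations are solved explicitly through `X`, which makes the system matrix equal to
  -- `a' * X * b'`.
  have hW : (1 - adjMatrix c) * Matrix.fromRows (b' + β * (X * b')) (X * b')
      = (decMatrix c i)ᵀ := by
    rw [hdec, Matrix.sub_mul, Matrix.one_mul, hadj, Matrix.fromBlocks_mul_fromRows]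
    have h2 : G.edgeMatrix K * (b' + β * (X * b')) = X * b' := by
      conv_rhs => rw [hX]
      simp only [Matrix.mul_add, Matrix.add_mul, Matrix.mul_assoc]
    ext p k
    rcases p with p | p
    · simp
    · simp [h2]
  refine ⟨c, ?_⟩
  have hu := (Matrix.isUnit_iff_isUnit_det _).1 (hG.isUnit_one_sub_adjMatrix c)
  rw [systemMatrix, Matrix.mul_assoc, ← hW, Matrix.nonsing_inv_mul_cancel_left _ _ hu, henc,
    Matrix.fromCols_mul_fromRows, Matrix.zero_mul, zero_add, ← Matrix.mul_assoc, hab']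

/-- Each variable occurs in a single column. -/
theorem affineIn_singleton_det_portMatrix (i : Fin N) (v : G.CodeVar S T R) :
    AffineIn {v} fun c : G.CodeVar S T R → K => (portMatrix c i).det := by
  have hport : ∀ e, v.output = some e →
      AffineIn {v} fun c : G.CodeVar S T R → K => (portMatrix c i).det := by
    intro e hv
    refine affineIn_det_portMatrix i {v} id (fun _ _ _ _ => rfl) (some (Sum.inl (Sum.inr e))) ?_
    intro c c' h p q hq
    refine portMatrix_apply_congr_of_output _ _ i e (fun w hw => h w ?_) p q (by simpa using hq)
    rintro rfl
    exact hw hv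
  rcases v with v | v | ⟨j, e', k⟩
  · exact hport _ rfl
  · exact hport _ rfl
  · refine affineIn_det_portMatrix i _ id (fun _ _ _ _ => rfl) (some (Sum.inr k)) ?_
    intro c c' h p q hq
    refine portMatrix_apply_congr_of_eps _ _ i (some k) (fun w hw => h w ?_)
      (fun e'' l hl => h _ ?_) p q hq
    · rintro rfl
      exact hw rfl
    · intro hcon
      simp only [Set.mem_singleton_iff, Sum.inr.injEq, Sigma.mk.injEq] at hcon
      obtain ⟨rfl, hcon⟩ := hcon
      exact hl (congrArg some (Prod.ext_iff.1 (eq_of_heq hcon)).2)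

/-- If the minimum cut between `S` and `T i` is at least `R`, then some code serves `T i`. -/
theorem exists_isUnit_systemMatrix {F : Type*} [Field F] [Fintype V] (hG : G.Acyclic) (i : Fin N)
    (hT : T i ≠ S) (hcut : R ≤ G.mincut F S (T i)) :
    ∃ c : G.CodeVar S T R → F, IsUnit (systemMatrix c i) := by
  -- Generic coefficients need an infinite field; the cut ranks remain at least `R` under the
  -- extension.
  let K := AlgebraicClosure F
  have hcutK : ∀ Ω : Finset V, S ∈ Ω → T i ∉ Ω →
      R ≤ (G.restrictTo Ω Ωᶜ (G.edgeMatrix K)).rank := by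
    intro Ω h1 h2
    have h3 : R ≤ (G.cutMatrix F Ω).rank := hcut.trans (Nat.sInf_le ⟨Ω, h1, h2, rfl⟩)
    obtain ⟨a, b, hab⟩ := (Matrix.le_rank_iff_exists_mul_mul_eq_one _ _).1 h3
    have h4 : R ≤ ((G.cutMatrix F Ω).map (algebraMap F K)).rank := by
      refine (Matrix.le_rank_iff_exists_mul_mul_eq_one _ _).2
        ⟨a.map (algebraMap F K), b.map (algebraMap F K), ?_⟩
      rw [← Matrix.map_mul, ← Matrix.map_mul, hab, Matrix.map_one _ (map_zero _) (map_one _)]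
    have h5 : (G.cutMatrix F Ω).map (algebraMap F K)
        = (G.restrictTo Ω Ωᶜ (G.edgeMatrix K)).submatrix Subtype.val Subtype.val := by
      ext ⟨e, he⟩ ⟨e', he'⟩
      simp [cutMatrix, restrictTo, edgeMatrix, he, he', apply_ite]
    rw [h5] at h4
    exact h4.trans (Matrix.rank_submatrix_le _ _ _)
  obtain ⟨c, hc⟩ := exists_systemMatrix_eq_one (K := K) hG i hT hcutK
  have hdet := (hG.isUnit_systemMatrix_iff c i).1 (hc ▸ isUnit_one)
  -- Values in `{0, 1}` bring the code back from `K` to `F`.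
  obtain ⟨c', h01, hdet'⟩ := exists_zero_one_ne_zero _ (affineIn_singleton_det_portMatrix i) c hdet
  have hlift : ∀ v, ∃ x : F, algebraMap F K x = c' v := by
    intro v
    rcases h01 v with h | h
    · exact ⟨0, by rw [h, map_zero]⟩
    · exact ⟨1, by rw [h, map_one]⟩
  choose x hx using hlift
  refine ⟨x, (hG.isUnit_systemMatrix_iff x i).2 fun h0 => hdet' ?_⟩
  have h1 := portMatrix_map (K := K) x i
  rw [show (fun v => algebraMap F K (x v)) = c' from funext hx] at h1
  simp only [h1]
  rw [← RingHom.mapMatrix_apply, ← RingHom.map_det, h0, map_zero]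

end Unicast

end ADTNetwork

/-! ### Decoding from the received symbols -/

namespace ADTNetwork

variable {V I O : Type*} {G : ADTNetwork V I O} {S : V} {N : ℕ} {T : Fin N → V} {R : ℕ}
  {F : Type*}

/-- Replace the decoding coefficients of a code. -/
def setDec (d : (Σ i : Fin N, G.InPort (T i) × Fin R) → F) (c : G.CodeVar S T R → F) :
    G.CodeVar S T R → F
  | Sum.inl p => c (Sum.inl p)
  | Sum.inr (Sum.inl p) => c (Sum.inr (Sum.inl p))
  | Sum.inr (Sum.inr p) => d p

section Decoding

variable [Field F] [DecidableEq V] [DecidableEq I] [DecidableEq O] [Fintype I] [Fintype O]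

/-- The matrix by which the received symbols depend on the source symbols. -/
noncomputable def receptionMatrix (c : G.CodeVar S T R → F) (i : Fin N) :
    Matrix (Fin R) (G.InPort (T i)) F :=
  (encMatrix c * (1 - adjMatrix c)⁻¹).submatrix id fun e => Sum.inl e.1

theorem systemMatrix_setDec (d : (Σ i : Fin N, G.InPort (T i) × Fin R) → F)
    (c : G.CodeVar S T R → F) (i : Fin N) :
    systemMatrix (setDec d c) i = receptionMatrix c i * Matrix.of fun e k => d ⟨i, e, k⟩ := by
  have h1 : adjMatrix (setDec d c) = adjMatrix c := by
    ext (p | p) (q | q) <;> rfl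
  have h2 : encMatrix (setDec d c) = encMatrix c := by
    ext k (p | p) <;> rfl
  rw [systemMatrix, h1, h2]
  ext k l
  rw [Matrix.mul_apply, Matrix.mul_apply, Fintype.sum_sum_type]
  simp only [receptionMatrix, decMatrix, Matrix.transpose_apply, Matrix.of_apply, mul_zero,
    Finset.sum_const_zero, add_zero, Matrix.submatrix_apply, id, mul_dite]
  rw [← Fintype.sum_subtype_add_sum_subtype fun e' => G.inNode e' = T i]
  rw [Finset.sum_eq_zero (s := (Finset.univ : Finset {e' // ¬ G.inNode e' = T i}))
    fun e' _ => dif_neg e'.2, add_zero]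
  exact Finset.sum_congr rfl fun e' _ => dif_pos e'.2

theorem canDecode_of_isUnit_setDec (d : (Σ i : Fin N, G.InPort (T i) × Fin R) → F)
    (c : G.CodeVar S T R → F) (i : Fin N) (h : IsUnit (systemMatrix (setDec d c) i)) :
    CanDecode c i := by
  refine ⟨fun y => y ᵥ* ((Matrix.of fun e k => d ⟨i, e, k⟩) * (systemMatrix (setDec d c) i)⁻¹),
    fun x => ?_⟩
  have h1 : received c i x = x ᵥ* receptionMatrix c i := rfl
  simp only
  rw [h1, Matrix.vecMul_vecMul, ← Matrix.mul_assoc, ← systemMatrix_setDec,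
    Matrix.mul_nonsing_inv _ ((Matrix.isUnit_iff_isUnit_det _).1 h), Matrix.vecMul_one]

/-- An arbitrary decoder, linear or not, makes the linear reception map injective, and hence a
linear decoder exists. -/
theorem CanDecode.exists_receptionMatrix_mul_eq_one {c : G.CodeVar S T R → F} {i : Fin N}
    (h : CanDecode c i) :
    ∃ b : Matrix (G.InPort (T i)) (Fin R) F, receptionMatrix c i * b = 1 := by
  obtain ⟨g, hg⟩ := h
  obtain ⟨a, ha⟩ := (receptionMatrix c i)ᵀ.exists_mul_eq_one_of_mulVec_injective (by
    refine Function.LeftInverse.injective (g := g) fun x => ?_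
    rw [Matrix.mulVec_transpose]
    exact hg x)
  exact ⟨aᵀ, by rw [← Matrix.transpose_inj, Matrix.transpose_mul, Matrix.transpose_transpose, ha,
    Matrix.transpose_one]⟩

end Decoding

/-! ### Groups of code variables and the probability bounds -/

section Groups

open Classical in
/-- The group of a code variable: the output port to which it belongs, if some edge leaves that
port, or the given index of an output process. -/
noncomputable def CodeVar.group (idx : Fin N → Fin R → Option ℕ) :
    G.CodeVar S T R → Option (O ⊕ ℕ)
  | Sum.inl p => if ∃ e', (p.2.1, e') ∈ G.edges then some (Sum.inl p.2.1) else none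
  | Sum.inr (Sum.inl p) => if ∃ e', (p.1.2, e') ∈ G.edges then some (Sum.inl p.1.2) else none
  | Sum.inr (Sum.inr p) => (idx p.1 p.2.2).map Sum.inr

theorem CodeVar.output_of_group_eq_inl {idx : Fin N → Fin R → Option ℕ} {v : G.CodeVar S T R}
    {e : O} (h : v.group idx = some (Sum.inl e)) :
    v.output = some e ∧ ∃ e', (e, e') ∈ G.edges := by
  rcases v with v | v | v <;> simp only [CodeVar.group] at h
  · split_ifs at h with h1
    simp only [Option.some.injEq, Sum.inl.injEq] at h
    subst h
    exact ⟨rfl, h1⟩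
  · split_ifs at h with h1
    simp only [Option.some.injEq, Sum.inl.injEq] at h
    subst h
    exact ⟨rfl, h1⟩
  · simp at h

theorem CodeVar.group_of_output {idx : Fin N → Fin R → Option ℕ} {v : G.CodeVar S T R} {e : O}
    (h : v.output = some e) (he : ∃ e', (e, e') ∈ G.edges) :
    v.group idx = some (Sum.inl e) := by
  rcases v with v | v | v <;> simp only [CodeVar.output, Option.some.injEq, reduceCtorEq] at h
  · subst h; exact if_pos he
  · subst h; exact if_pos he

theorem CodeVar.exists_eps_of_group_eq_inr {idx : Fin N → Fin R → Option ℕ}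
    {v : G.CodeVar S T R} {j : ℕ} (h : v.group idx = some (Sum.inr j)) :
    ∃ i e' k, v = CodeVar.ε i e' k ∧ idx i k = some j := by
  rcases v with v | v | ⟨i, e', k⟩ <;> simp only [CodeVar.group] at h
  · split_ifs at h
    simp at h
  · split_ifs at h
    simp at h
  · exact ⟨i, e', k, rfl, by simpa using h⟩

/-- An injection of `Fin R` into the natural numbers that numbers a given set from zero. -/
theorem exists_injective_lt_card (D : Set (Fin R)) :
    ∃ f : Fin R → ℕ, Function.Injective f ∧ ∀ k ∈ D, f k < Nat.card D := by
  classical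
  have hcard : Nat.card D ≤ R := by
    simpa using Nat.card_le_card_of_injective (Subtype.val : D → Fin R) Subtype.val_injective
  let e := Finite.equivFin D
  -- The shift by `R ≥ Nat.card D` keeps the numbers outside `D` apart from those inside.
  refine ⟨fun k => if h : k ∈ D then e ⟨k, h⟩ else R + k, fun k l hkl => ?_, fun k hk => ?_⟩
  · by_cases hk : k ∈ D <;> by_cases hl : l ∈ D <;> simp only [hk, hl, dite_true, dite_false] at hkl
    · exact congrArg Subtype.val (e.injective (Fin.ext hkl))
    · have := (e ⟨k, hk⟩).2
      omega
    · have := (e ⟨l, hl⟩).2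
      omega
    · exact Fin.ext (by omega)
  · simpa only [hk, dite_true] using (e ⟨k, hk⟩).2

/-- The bound on `R` is indexed by destinations because a cut supplies it only when a destination
exists; for `N = 0` the supremum is `0`. -/
theorem numRandomOutputs_le {n : ℕ} (J : Set (G.CodeVar S T R)) (hR : ∀ _ : Fin N, R ≤ n) :
    numRandomOutputs J ≤ n := by
  refine Finset.sup_le fun i _ => le_trans ?_ (hR i)
  simpa using Nat.card_le_card_of_injective (Subtype.val : {k : Fin R // ∃ e' : G.InPort (T i),
    (CodeVar.ε i e' k : G.CodeVar S T R) ∈ J} → Fin R) Subtype.val_injective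

/-- The cut `{S}` has at most as many columns as there are input ports. -/
theorem le_card_of_le_mincut [Fintype I] [Field F] [DecidableEq V] [DecidableEq I]
    [DecidableEq O] {D : V} (hD : D ≠ S) (hcut : R ≤ G.mincut F S D) :
    R ≤ Fintype.card I := by
  have h : G.mincut F S D ≤ (G.cutMatrix F {S}).rank :=
    Nat.sInf_le ⟨{S}, Finset.mem_singleton_self S, by simpa using hD, rfl⟩
  exact hcut.trans (h.trans ((Matrix.rank_le_card_width _).trans (Fintype.card_subtype_le _)))

variable [Fintype I] [Fintype O] [Field F] [Fintype F]

theorem pow_le_randomCodeProb {κ : Type*} (hN : N ≤ Fintype.card F)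
    (grp : G.CodeVar S T R → Option κ) (h : Fin N → (G.CodeVar S T R → F) → F)
    (hh : ∀ i k, AffineIn {v | grp v = some k} (h i))
    (hnone : ∀ i c c', (∀ v, grp v ≠ none → c v = c' v) → h i c ≠ 0 → h i c' ≠ 0)
    (J : Set (G.CodeVar S T R)) (A : Finset κ) (hA : ∀ v ∈ J, ∀ k, grp v = some k → k ∈ A)
    (c₀ : G.CodeVar S T R → F) (hne : ∀ i, ∃ c, AgreeOff J c₀ c ∧ h i c ≠ 0)
    (P : (G.CodeVar S T R → F) → Prop) (hP : ∀ c, (∀ i, h i c ≠ 0) → P c) :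
    (1 - (N : ℝ) / Fintype.card F) ^ A.card ≤ randomCodeProb J c₀ P := by
  classical
  have hJ : {v ∈ J | ∀ k, grp v = some k → k ∈ A} = J := by
    ext v
    exact ⟨fun hv => hv.1, fun hv => ⟨hv, hA v hv⟩⟩
  have key := pow_mul_card_le_card_filter_ne_zero hN grp h hh hnone J A c₀ (by
    intro i
    obtain ⟨c, hc, hn⟩ := hne i
    rw [hJ]
    exact ⟨c, mem_agreeOff.2 hc, hn⟩)
  rw [hJ] at key
  have hpos : (0 : ℝ) < (agreeOff J c₀).card := by exact_mod_cast card_agreeOff_pos J c₀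
  have h1 : Nat.card {c : G.CodeVar S T R → F // AgreeOff J c₀ c} = (agreeOff J c₀).card :=
    Nat.subtype_card _ fun _ => mem_agreeOff
  have h2 : Nat.card {c : G.CodeVar S T R → F // AgreeOff J c₀ c ∧ P c}
      = ((agreeOff J c₀).filter P).card :=
    Nat.subtype_card _ fun _ => by rw [Finset.mem_filter, mem_agreeOff]; rfl
  rw [randomCodeProb, h1, h2, le_div_iff₀ hpos]
  refine key.trans ?_
  exact_mod_cast Finset.card_le_card (Finset.monotone_filter_right _ fun c _ hc => hP c hc)

/-- The output ports that carry random combinations. -/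
theorem exists_card_eq_numRandomLinks (J : Set (G.CodeVar S T R)) :
    ∃ A : Finset O, A.card = numRandomLinks J ∧ (∀ e ∈ A, ∃ e', (e, e') ∈ G.edges) ∧
      ∀ v ∈ J, ∀ e, v.output = some e → (∃ e', (e, e') ∈ G.edges) → e ∈ A := by
  classical
  refine ⟨Finset.univ.filter fun e => (∃ e', (e, e') ∈ G.edges) ∧
    ((∃ (k : Fin R) (h : G.outNode e = S), (CodeVar.α k ⟨e, h⟩ : G.CodeVar S T R) ∈ J) ∨
      ∃ (e' : I) (h : G.inNode e' = G.outNode e),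
        (CodeVar.β e' e h : G.CodeVar S T R) ∈ J), ?_, ?_, ?_⟩
  · exact (Nat.subtype_card _ fun _ => by simp).symm
  · exact fun e he => (Finset.mem_filter.1 he).2.1
  · intro v hv e hve he
    refine Finset.mem_filter.2 ⟨Finset.mem_univ e, he, ?_⟩
    rcases v with ⟨k, e, h⟩ | ⟨⟨e', e⟩, h⟩ | v <;>
      simp only [CodeVar.output, Option.some.injEq, reduceCtorEq] at hve
    · subst hve; exact Or.inl ⟨k, h, hv⟩
    · subst hve; exact Or.inr ⟨e', h, hv⟩

theorem numRandomLinks_le_card_edges (J : Set (G.CodeVar S T R)) :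
    numRandomLinks J ≤ G.edges.card := by
  classical
  obtain ⟨A, hA, hedge, -⟩ := exists_card_eq_numRandomLinks J
  rw [← hA]
  refine (Finset.card_le_card fun e he => ?_).trans (Finset.card_image_le (f := Prod.fst))
  obtain ⟨e', h⟩ := hedge e he
  exact Finset.mem_image.2 ⟨_, h, rfl⟩

variable [Fintype V] [DecidableEq V] [DecidableEq I] [DecidableEq O]

/-- Random coding, when the destinations decode from the symbols that they receive. -/
theorem Acyclic.pow_le_randomCodeProb_canDecode (hG : G.Acyclic) (hN : N ≤ Fintype.card F)
    (J : Set (G.CodeVar S T R)) (c₀ : G.CodeVar S T R → F)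
    (hne : ∀ i, ∃ c, AgreeOff J c₀ c ∧ CanDecode c i) :
    (1 - (N : ℝ) / Fintype.card F) ^ numRandomLinks J ≤
      randomCodeProb J c₀ fun c => ∀ i, CanDecode c i := by
  classical
  obtain ⟨A, hA, -, hAJ⟩ := exists_card_eq_numRandomLinks J
  choose w hw hdec using hne
  choose b hb using fun i => (hdec i).exists_receptionMatrix_mul_eq_one
  -- Each `T i` keeps the linear decoder of its own witness `w i`. The drawn decoding coefficients
  -- are overridden by `d`, so they belong to no group.
  let d : (Σ i : Fin N, G.InPort (T i) × Fin R) → F := fun p => b p.1 p.2.1 p.2.2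
  have hout : ∀ c c' : G.CodeVar S T R → F, (∀ v, v.output ≠ none → c v = c' v) →
      setDec d c = setDec d c' := by
    intro c c' h
    funext v
    rcases v with v | v | v
    · exact h _ (by simp [CodeVar.output])
    · exact h _ (by simp [CodeVar.output])
    · rfl
  rw [← hA, ← Finset.card_map (s := A) Function.Embedding.inl]
  refine pow_le_randomCodeProb (κ := O ⊕ ℕ) hN (CodeVar.group fun _ _ => none)
    (fun i c => (portMatrix (setDec d c) i).det) ?_ ?_ J _ ?_ c₀ ?_ _ ?_
  · rintro i (e | j)
    · refine affineIn_det_portMatrix i _ (setDec d) ?_ (some (Sum.inl (Sum.inr e))) ?_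
      · intro c c' c'' t
        funext v
        rcases v with v | v | v <;> simp [setDec]
      · intro c c' h p q hq
        refine portMatrix_apply_congr_of_output _ _ i e (fun v hv => ?_) p q (by simpa using hq)
        have hv' := h v fun h' => hv (CodeVar.output_of_group_eq_inl h').1
        rcases v with v | v | v
        · exact hv'
        · exact hv'
        · rfl
    · intro c c' c'' t h' h''
      have hj : ∀ v : G.CodeVar S T R,
          v ∉ {v : G.CodeVar S T R | v.group (fun _ _ => none) = some (Sum.inr j)} := by
        intro v hv
        obtain ⟨_, _, _, _, h⟩ := CodeVar.exists_eps_of_group_eq_inr hv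
        cases h
      obtain rfl : c' = c := funext fun v => h' v (hj v)
      obtain rfl : c'' = c' := funext fun v => h'' v (hj v)
      simp
  · intro i c c' h hc
    rw [← hG.isUnit_systemMatrix_iff] at hc ⊢
    rwa [← hG.systemMatrix_congr (setDec d c) (setDec d c') i]
    intro v hv
    rcases v with v | v | v
    · exact h _ (by rw [CodeVar.group_of_output rfl (hv _ rfl)]; simp)
    · exact h _ (by rw [CodeVar.group_of_output rfl (hv _ rfl)]; simp)
    · rfl
  · rintro v hv (e | j) hk
    · obtain ⟨h1, h2⟩ := CodeVar.output_of_group_eq_inl hk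
      exact Finset.mem_map_of_mem _ (hAJ v hv e h1 h2)
    · obtain ⟨_, _, _, _, h⟩ := CodeVar.exists_eps_of_group_eq_inr hk
      cases h
  · intro i
    refine ⟨w i, hw i, (hG.isUnit_systemMatrix_iff _ i).1 ?_⟩
    rw [systemMatrix_setDec]
    exact (hb i).symm ▸ isUnit_one
  · exact fun c hc i => canDecode_of_isUnit_setDec d c i ((hG.isUnit_systemMatrix_iff _ i).2 (hc i))

/-- Random coding, when the decoding coefficients are drawn as well. -/
theorem Acyclic.pow_le_randomCodeProb_isUnit (hG : G.Acyclic) (hN : N ≤ Fintype.card F)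
    (J : Set (G.CodeVar S T R)) (c₀ : G.CodeVar S T R → F)
    (hne : ∀ i, ∃ c, AgreeOff J c₀ c ∧ IsUnit (systemMatrix c i)) :
    (1 - (N : ℝ) / Fintype.card F) ^ (numRandomLinks J + numRandomOutputs J) ≤
      randomCodeProb J c₀ fun c => ∀ i, IsUnit (systemMatrix c i) := by
  classical
  obtain ⟨A, hA, -, hAJ⟩ := exists_card_eq_numRandomLinks J
  choose f hfinj hf using fun i : Fin N => exists_injective_lt_card
    {k : Fin R | ∃ e' : G.InPort (T i), (CodeVar.ε i e' k : G.CodeVar S T R) ∈ J}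
  -- The processes with random decoding coefficients are numbered from `0` at every destination, and
  -- equal numbers share a group; so `numRandomOutputs J` groups suffice.
  let idx : Fin N → Fin R → Option ℕ := fun i k => some (f i k)
  have hcard : (A.disjSum (Finset.range (numRandomOutputs J))).card
      = numRandomLinks J + numRandomOutputs J := by
    rw [Finset.card_disjSum, hA, Finset.card_range]
  rw [← hcard]
  refine pow_le_randomCodeProb (κ := O ⊕ ℕ) hN (CodeVar.group idx)
    (fun i c => (portMatrix c i).det) ?_ ?_ J _ ?_ c₀ ?_ _ ?_
  · rintro i (e | j)
    · refine affineIn_det_portMatrix i _ id (fun _ _ _ _ => rfl) (some (Sum.inl (Sum.inr e))) ?_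
      intro c c' h p q hq
      exact portMatrix_apply_congr_of_output _ _ i e
        (fun v hv => h v fun h' => hv (CodeVar.output_of_group_eq_inl h').1) p q (by simpa using hq)
    · obtain ⟨k, hk⟩ : ∃ k : Option (Fin R), ∀ l, f i l = j → some l = k := by
        by_cases hex : ∃ k, f i k = j
        · obtain ⟨k, rfl⟩ := hex
          exact ⟨some k, fun l hl => congrArg some (hfinj i hl)⟩
        · exact ⟨none, fun l hl => absurd ⟨l, hl⟩ hex⟩
      refine affineIn_det_portMatrix i _ id (fun _ _ _ _ => rfl) (k.map Sum.inr) ?_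
      intro c c' h p q hq
      refine portMatrix_apply_congr_of_eps _ _ i k (fun v hv => h v fun h' => ?_)
        (fun e' l hl => h _ fun h' => hl (hk l ?_)) p q hq
      · obtain ⟨_, _, _, rfl, _⟩ := CodeVar.exists_eps_of_group_eq_inr h'
        exact hv rfl
      · simpa [CodeVar.group, idx] using h'
  · intro i c c' h hc
    rw [← hG.isUnit_systemMatrix_iff] at hc ⊢
    rwa [← hG.systemMatrix_congr c c' i]
    intro v hv
    rcases v with v | v | v
    · exact h _ (by rw [CodeVar.group_of_output rfl (hv _ rfl)]; simp)
    · exact h _ (by rw [CodeVar.group_of_output rfl (hv _ rfl)]; simp)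
    · exact h _ (by simp [CodeVar.group, idx])
  · rintro v hv (e | j) hk
    · obtain ⟨h1, h2⟩ := CodeVar.output_of_group_eq_inl hk
      exact Finset.inl_mem_disjSum.2 (hAJ v hv e h1 h2)
    · obtain ⟨i, e', k, rfl, h⟩ := CodeVar.exists_eps_of_group_eq_inr hk
      obtain rfl : f i k = j := Option.some.inj h
      refine Finset.inr_mem_disjSum.2 (Finset.mem_range.2 ((hf i k ⟨e', hv⟩).trans_le ?_))
      exact Finset.le_sup (f := fun i : Fin N => Nat.card {k : Fin R // ∃ e' : G.InPort (T i),
        (CodeVar.ε i e' k : G.CodeVar S T R) ∈ J}) (Finset.mem_univ i)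
  · intro i
    obtain ⟨c, hc, hu⟩ := hne i
    exact ⟨c, hc, (hG.isUnit_systemMatrix_iff c i).1 hu⟩
  · exact fun c hc i => (hG.isUnit_systemMatrix_iff c i).2 (hc i)

end Groups

end ADTNetwork

theorem mainTheorem10 {V I O : Type*} [Fintype V] [Fintype I] [Fintype O]
    [DecidableEq V] [DecidableEq I] [DecidableEq O] {F : Type*} [Field F] [Fintype F]
    (G : ADTNetwork V I O) (hG : G.Acyclic)
    (S : V) (N : ℕ) (T : Fin N → V) (hT : ∀ i, T i ≠ S) (R : ℕ)
    (hq : N < Fintype.card F) (hcut : ∀ i, R ≤ G.mincut F S (T i)) :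
    -- the multicast is solvable
    (∃ c : G.CodeVar S T R → F, ∀ i, IsUnit (ADTNetwork.systemMatrix c i)) ∧
    -- the variables in `J` are random, the others keep their values in `c₀`
    ∀ (J : Set (G.CodeVar S T R)) (c₀ : G.CodeVar S T R → F),
      -- every destination can recover the source symbols from what it receives
      ((∀ i, ∃ c, ADTNetwork.AgreeOff J c₀ c ∧ ADTNetwork.CanDecode c i) →
        (1 - (N : ℝ) / (Fintype.card F : ℝ)) ^ ADTNetwork.numRandomLinks J ≤
          ADTNetwork.randomCodeProb J c₀ (fun c => ∀ i, ADTNetwork.CanDecode c i)) ∧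
      -- the system matrix, formed with the drawn decoding coefficients, is invertible
      ((∀ i, ∃ c, ADTNetwork.AgreeOff J c₀ c ∧ IsUnit (ADTNetwork.systemMatrix c i)) →
        (1 - (N : ℝ) / (Fintype.card F : ℝ)) ^
            (ADTNetwork.numRandomLinks J + ADTNetwork.numRandomOutputs J) ≤
          ADTNetwork.randomCodeProb J c₀
            (fun c => ∀ i, IsUnit (ADTNetwork.systemMatrix c i))) ∧
      ADTNetwork.numRandomLinks J ≤ G.edges.card ∧
      ADTNetwork.numRandomLinks J + ADTNetwork.numRandomOutputs J ≤
        Fintype.card I + Fintype.card O := by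

  have hq' : N ≤ Fintype.card F := hq.le
  refine ⟨?_, fun J c₀ => ⟨hG.pow_le_randomCodeProb_canDecode hq' J c₀,
    hG.pow_le_randomCodeProb_isUnit hq' J c₀, ADTNetwork.numRandomLinks_le_card_edges J, ?_⟩⟩
  -- With all variables random, the probability that every `M i` is invertible is positive, so a
  -- common code exists.
  · have h1 := hG.pow_le_randomCodeProb_isUnit (S := S) (T := T) (R := R) hq' Set.univ
      (0 : G.CodeVar S T R → F)
      fun i => by
        obtain ⟨c, hc⟩ := ADTNetwork.exists_isUnit_systemMatrix hG i (hT i) (hcut i)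
        exact ⟨c, fun v hv => absurd (Set.mem_univ v) hv, hc⟩
    have hpos : 0 < 1 - (N : ℝ) / Fintype.card F := by
      have h0 : (0 : ℝ) < Fintype.card F := by exact_mod_cast Fintype.card_pos
      rw [sub_pos, div_lt_one h0]
      exact_mod_cast hq
    by_contra! hcon
    have h2 : ADTNetwork.randomCodeProb Set.univ (0 : G.CodeVar S T R → F)
        (fun c => ∀ i, IsUnit (ADTNetwork.systemMatrix c i)) = 0 := by
      have : IsEmpty {c : G.CodeVar S T R → F // ADTNetwork.AgreeOff Set.univ 0 c ∧
          ∀ i, IsUnit (ADTNetwork.systemMatrix c i)} :=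
        ⟨fun c => (hcon c.1).elim fun i hi => hi (c.2.2 i)⟩
      rw [ADTNetwork.randomCodeProb, Nat.card_of_isEmpty, Nat.cast_zero, zero_div]
    rw [h2] at h1
    exact absurd h1 (not_le.2 (pow_pos hpos _))
  -- The random links are output ports, and `δ ≤ R` is at most the number of input ports.
  · obtain ⟨A, hA, -, -⟩ := ADTNetwork.exists_card_eq_numRandomLinks J
    rw [add_comm (Fintype.card I), ← hA]
    exact Nat.add_le_add (Finset.card_le_univ A) (ADTNetwork.numRandomOutputs_le J fun i =>
      ADTNetwork.le_card_of_le_mincut (hT i) (hcut i))
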